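/- Perturbation of all real singular tuples of an orthogonally decomposable tensor. Notation. Let $p\ge 3$. For $A\in\mathbb R^{d_1\times\cdots\times d_p}$ let $\|A\|=\max\langle A,x^{(1)}\otimes\cdots\otimes x^{(p)}\rangle$, the maximum being over unit vectors $x^{(q)}\in\mathbb R^{d_q}$; for a matrix, $\|\cdot\|$ is the spectral norm. Write $A\times_{s\ne q}x^{(s)}\in\mathbb R^{d_q}$ for the contraction of $A$ with $x^{(s)}$ in every mode $s\neq q$. A tuple $(\lambda,v^{(1)},\dots,v^{(p)})$ with $\lambda\in\mathbb R$, $v^{(q)}\in\mathbb R^{d_q}$, $\|v^{(q)}\|=1$ is a (real) singular tuple of $A$ if $A\times_{s\ne q}v^{(s)}=\lambda v^{(q)}$ for all $q$. With $d_{\min}=\min_q d_q$, $A$ is odeco if $A=\sum_{k=1}^{d_{\min}}\lambda_k\,u_k^{(1)}\otimes\cdots\otimes u_k^{(p)}$ with $\lambda_1\ge\cdots\ge\lambda_{d_{\min}}\ge 0$ and $u_1^{(q)},\dots,u_{d_{\min}}^{(q)}$ orthonormal for every $q$. Theorem. For every $p\ge3$ and $C_1,C_2>0$ there is a constant $C>0$,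 depending on $p,C_1,C_2$ only, such that the following holds for all dimensions $d_1,\dots,d_p$. Let $T,\tilde T\in\mathbb R^{d_1\times\cdots\times d_p}$ be odeco, let $T=\sum_{k=1}^{d_{\min}}\lambda_k u_k^{(1)}\otimes\cdots\otimes u_k^{(p)}$ be a decomposition as above, and let $r\ge1$ be the number of nonzero $\lambda_k$. Let $M^{(q)}$ be the $d_q\times r$ matrix with columns $(\tilde T-T)\times_{s\neq q}u_k^{(s)}$, $k=1,\dots,r$, and assume $$\max_{1\le q\le p}\|M^{(q)}\|\le C_1\|\tilde T-T\|,\qquad \|\tilde T-T\|\le C_2\,\lambda_r\,r^{-\frac1{2(p-2)}} .$$ Then for every singular tuple $(\lambda,v^{(1)},\dots,v^{(p)})$ of $T$ there is a singular tuple $(\tilde\lambda,\tilde v^{(1)},\dots,\tilde v^{(p)})$ of $\tilde T$ with $$\max_{1\le q\le p}\|v^{(q)}-\tilde v^{(q)}\|\le\frac{C\|\tilde T-T\|}{\lambda^*_{\min}},\qquad\text{and, if }\lambda>0,\text{ also}\qquad |\tilde\lambda-\lambda|\le\frac{C\lambda\|\tilde T-T\|}{\lambda^*_{\min}} .$$ Here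 $\lambda^*_{\min}=\min\{\lambda_k:k\in S\}$, where $S=\{k:\langle v^{(q)},u_k^{(q)}\rangle\ne0\text{ for some }q\}$ if $v^{(q)}\in\operatorname{span}\{u^{(q)}_1,\dots,u^{(q)}_{d_{\min}}\}$ for every $q$, and $S=\{1,\dots,d_{\min}\}$ otherwise; we use $1/0=+\infty$ (and $0\cdot\infty=0$). If $\lambda\neq0$, then $S=\{k:\langle v^{(1)},u_k^{(1)}\rangle\neq 0\}$, so $\lambda^*_{\min}=\min\{\lambda_k:|\langle v^{(1)},u^{(1)}_k\rangle|>0\}$. -/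

import Mathlib

open scoped BigOperators

noncomputable section

namespace OdecoTensor

/-- Real tensors of order `p` and format `d 0 × ⋯ × d (p - 1)`. -/
abbrev Tensor {p : ℕ} (d : Fin p → ℕ) : Type := (∀ q, Fin (d q)) → ℝ

/-- A family with one Euclidean vector for each mode. -/
abbrev Vecs {p : ℕ} (d : Fin p → ℕ) : Type := ∀ q, EuclideanSpace ℝ (Fin (d q))

variable {p : ℕ} {d : Fin p → ℕ}

/-- The rank-one tensor `x⁽¹⁾ ⊗ ⋯ ⊗ x⁽ᵖ⁾`. -/
def rankOne (x : Vecs d) : Tensor d := fun i => ∏ q, x q (i q)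

/-- The entrywise inner product `⟨T, x⁽¹⁾ ⊗ ⋯ ⊗ x⁽ᵖ⁾⟩`. -/
def pairing (T : Tensor d) (x : Vecs d) : ℝ := ∑ i, T i * rankOne x i

/-- The contraction `T ×_{j ≠ q} x⁽ʲ⁾`, a vector in mode `q`; its `a`-th coordinate is the pairing of
`T` with the rank-one tensor whose `q`-th factor is `e_a` and whose other factors are `x⁽ʲ⁾`
(in particular `x⁽q⁾` is not used). -/
def contract (T : Tensor d) (q : Fin p) (x : Vecs d) : EuclideanSpace ℝ (Fin (d q)) :=
  WithLp.toLp 2 fun a => pairing T (Function.update x q (EuclideanSpace.single a 1))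

/-- The spectral norm of a tensor: the largest value of `⟨T, x⁽¹⁾ ⊗ ⋯ ⊗ x⁽ᵖ⁾⟩` over unit vectors. -/
def tensorNorm (T : Tensor d) : ℝ :=
  sSup {t : ℝ | ∃ x : Vecs d, (∀ q, ‖x q‖ = 1) ∧ pairing T x = t}

/-- The spectral norm (largest singular value) of a matrix. -/
def matNorm {m n : ℕ} (M : Matrix (Fin m) (Fin n) ℝ) : ℝ :=
  ‖(Matrix.toEuclideanLin M).toContinuousLinearMap‖

/-- The smallest dimension `d_min`. -/
def minDim {p : ℕ} (d : Fin p → ℕ) : ℕ := ⨅ q, d q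

/-- `T = ∑ₖ λₖ uₖ⁽¹⁾ ⊗ ⋯ ⊗ uₖ⁽ᵖ⁾` (`k` running over `d_min` indices) with
`λ₁ ≥ λ₂ ≥ ⋯ ≥ 0` and orthonormal vectors in every mode. -/
structure IsSVD (T : Tensor d) (lam : Fin (minDim d) → ℝ)
    (u : ∀ q, Fin (minDim d) → EuclideanSpace ℝ (Fin (d q))) : Prop where
  antitone : Antitone lam
  nonneg : ∀ k, 0 ≤ lam k
  orthonormal : ∀ q, Orthonormal ℝ (u q)
  eq_sum : T = ∑ k, lam k • rankOne (fun q => u q k)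

/-- Orthogonally decomposable tensors. -/
def IsOdeco (T : Tensor d) : Prop := ∃ lam u, IsSVD T lam u

/-- `(l, v⁽¹⁾, …, v⁽ᵖ⁾)` is a real singular value/vector tuple of `T`. -/
def IsSingularTuple (T : Tensor d) (l : ℝ) (v : Vecs d) : Prop :=
  (∀ q, ‖v q‖ = 1) ∧ ∀ q, contract T q v = l • v q

/-- The matrix with the `r` columns `E ×_{s ≠ q} uₖ⁽ˢ⁾`, `k = 1, …, r`. -/
def contractMatrix (E : Tensor d) {r : ℕ} (hr : r ≤ minDim d)
    (u : ∀ q, Fin (minDim d) → EuclideanSpace ℝ (Fin (d q))) (q : Fin p) :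
    Matrix (Fin (d q)) (Fin r) ℝ :=
  Matrix.of fun a k => contract E q (fun s => u s (Fin.castLE hr k)) a

/-- The active indices of a tuple `v`: those `k` for which some `v⁽q⁾` has a nonzero component along
`uₖ⁽q⁾`; all indices count as active if some `v⁽q⁾` is not in the span of the `uₖ⁽q⁾`.
For singular tuples with a nonzero singular value, this is the set of `k` with
`⟨v⁽¹⁾, uₖ⁽¹⁾⟩ ≠ 0`, see `activeSet_eq`. -/
def activeSet (u : ∀ q, Fin (minDim d) → EuclideanSpace ℝ (Fin (d q))) (v : Vecs d) :
    Set (Fin (minDim d)) :=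
  {k | (∃ q, inner ℝ (v q) (u q k) ≠ 0) ∨ ∃ q, v q ∉ Submodule.span ℝ (Set.range (u q))}

/-- `λ*_min`: the smallest `λₖ` over the active indices (`0` if there are none). -/
def lamStar (lam : Fin (minDim d) → ℝ)
    (u : ∀ q, Fin (minDim d) → EuclideanSpace ℝ (Fin (d q))) (v : Vecs d) : ℝ :=
  sInf (lam '' activeSet u v)

theorem pairing_rankOne (x y : Vecs d) :
    pairing (rankOne x) y = ∏ q, inner ℝ (x q) (y q) := by
  simp only [pairing, rankOne, ← Finset.prod_mul_distrib, PiLp.inner_apply, RCLike.inner_apply,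
    conj_trivial]
  rw [Finset.prod_univ_sum]
  simp only [Fintype.piFinset_univ]
  exact Finset.sum_congr rfl fun i _ => Finset.prod_congr rfl fun q _ => mul_comm _ _

theorem contract_rankOne (x v : Vecs d) (q : Fin p) :
    contract (rankOne x) q v = (∏ s ∈ Finset.univ.erase q, inner ℝ (x s) (v s)) • x q := by
  ext a
  simp only [contract, pairing_rankOne, PiLp.smul_apply, smul_eq_mul]
  rw [← Finset.mul_prod_erase Finset.univ _ (Finset.mem_univ q), mul_comm]
  congr 1
  · exact Finset.prod_congr rfl fun s hs => by
      rw [Function.update_of_ne (Finset.ne_of_mem_erase hs)]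
  · simp [EuclideanSpace.inner_single_right]

theorem contract_svd {T : Tensor d} {lam : Fin (minDim d) → ℝ}
    {u : ∀ q, Fin (minDim d) → EuclideanSpace ℝ (Fin (d q))} (h : IsSVD T lam u)
    (v : Vecs d) (q : Fin p) :
    contract T q v =
      ∑ k, (lam k * ∏ s ∈ Finset.univ.erase q, inner ℝ (u s k) (v s)) • u q k := by
  have key : contract T q v = ∑ k, lam k • contract (rankOne fun q => u q k) q v := by
    rw [h.eq_sum]
    ext a
    simp only [contract, pairing, WithLp.ofLp_sum, Finset.sum_apply, Pi.smul_apply, smul_eq_mul,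
      WithLp.ofLp_smul, Finset.sum_mul, Finset.mul_sum]
    rw [Finset.sum_comm]
    exact Finset.sum_congr rfl fun k _ => Finset.sum_congr rfl fun i _ => by ring
  rw [key]
  simp only [contract_rankOne, smul_smul]

/-- For a nonzero singular value the active indices can be read off from any single mode. -/
theorem activeSet_eq {T : Tensor d} {lam : Fin (minDim d) → ℝ}
    {u : ∀ q, Fin (minDim d) → EuclideanSpace ℝ (Fin (d q))} (h : IsSVD T lam u)
    {l : ℝ} {v : Vecs d} (hv : IsSingularTuple T l v) (hl : l ≠ 0) (q₀ : Fin p) :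
    activeSet u v = {k | inner ℝ (v q₀) (u q₀ k) ≠ 0} := by
  have hvq : ∀ q, v q = l⁻¹ • contract T q v := fun q => by
    rw [hv.2 q, smul_smul, inv_mul_cancel₀ hl, one_smul]
  have hspan : ∀ q, v q ∈ Submodule.span ℝ (Set.range (u q)) := fun q => by
    rw [hvq q, contract_svd h]
    exact Submodule.smul_mem _ _ (Submodule.sum_mem _ fun k _ =>
      Submodule.smul_mem _ _ (Submodule.subset_span ⟨k, rfl⟩))
  have hcoef : ∀ q k, l * inner ℝ (u q k) (v q) =
      lam k * ∏ s ∈ Finset.univ.erase q, inner ℝ (u s k) (v s) := fun q k => by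
    have h1 := congrArg (fun w => inner ℝ (u q k) w) (hv.2 q)
    simp only [contract_svd h, (h.orthonormal q).inner_right_fintype, inner_smul_right] at h1
    exact h1.symm
  have hall : ∀ q q' k, inner ℝ (u q k) (v q) ≠ 0 → inner ℝ (u q' k) (v q') ≠ 0 := by
    intro q q' k hq h0
    by_cases hqq : q' = q
    · exact hq (hqq ▸ h0)
    · have h2 := hcoef q k
      rw [Finset.prod_eq_zero (Finset.mem_erase.2 ⟨hqq, Finset.mem_univ q'⟩) h0, mul_zero] at h2
      exact (mul_ne_zero hl hq) h2
  ext k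
  simp only [activeSet, Set.mem_ofPred_eq]
  constructor
  · rintro (⟨q, hq⟩ | ⟨q, hq⟩)
    · rw [real_inner_comm] at hq ⊢
      exact hall q q₀ k hq
    · exact absurd (hspan q) hq
  · exact fun hk => Or.inl ⟨q₀, hk⟩

end OdecoTensor

end

/-! Write `ε` for the norm of `T' - T`, `L` for `lamStar` and `δ = ε / L`.

Contracting an odeco tensor with `u q k` in all modes but two leaves a matrix that is diagonal in
its own orthonormal vectors. For `T'` this matrix is `ε`-close to a rank-one matrix of size `lam k`,
so a single component of `T'` dominates it. Hence every component of `T` with `lam k ≥ 4ε` has a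
unique partner in `T'`, with no gap between the `lam k` required (`exists_matches`).

A singular vector may mix many components, so closeness has to hold for whole linear combinations,
without loss in the dimension. With `w k` the partner of `u k`, signs adjusted, expanding the
contraction of `T'` writes `lam k • (u k - w k)` as minus a column of the perturbation matrix, plus
a multiple of `w k`, plus a remainder of order `ε δ^(p-2)`. The columns are controlled jointly by
the matrix norm hypothesis and the multiples by orthonormality. Summing remainders costs `√r`, which
the second hypothesis absorbs, since it gives `√r δ^(p-2) ≤ C₂^(p-2)`
(`norm_sum_smul_sub_aligned_le`).

If `l > 0`, the coefficients `a k` of `v` have the same absolute value in all modes, and `l = lam k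
* |a k|^(p-2)` on the active indices. Transporting them to `w` and multiplying by factors near 1
restores these equations for `T'` (`exists_rescale`). If `l = 0`, the unscaled coefficients work,
and a component of `v` outside the span is moved to a nearby vector orthogonal to `w`
(`exists_orthogonal_near`).

For large `δ` the vector bound is trivial. The bound on the value then follows by picking a
component of `T'` of size `O(ε)` and comparing `ε` with `l δ`. -/

namespace OdecoTensor

/-! ### Spectral norm and contractions -/

section Contraction

variable {p : ℕ} {d : Fin p → ℕ}

theorem abs_rankOne_le_prod_norm (x : Vecs d) (i : ∀ q, Fin (d q)) :
    |rankOne x i| ≤ ∏ q, ‖x q‖ := by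
  rw [rankOne, Finset.abs_prod]
  exact Finset.prod_le_prod (fun _ _ => abs_nonneg _)
    fun q _ => by simpa using PiLp.norm_apply_le (x q) (i q)

theorem bddAbove_pairing_unit (T : Tensor d) :
    BddAbove {t : ℝ | ∃ x : Vecs d, (∀ q, ‖x q‖ = 1) ∧ pairing T x = t} := by
  refine ⟨∑ i, |T i|, ?_⟩
  rintro _ ⟨x, hx, rfl⟩
  refine Finset.sum_le_sum fun i _ => (le_abs_self _).trans ?_
  rw [abs_mul]
  have h := abs_rankOne_le_prod_norm x i
  simp only [hx, Finset.prod_const_one] at h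
  exact mul_le_of_le_one_right (abs_nonneg _) h

theorem pairing_le_tensorNorm (T : Tensor d) {x : Vecs d} (hx : ∀ q, ‖x q‖ = 1) :
    pairing T x ≤ tensorNorm T :=
  le_csSup (bddAbove_pairing_unit T) ⟨x, hx, rfl⟩

theorem rankOne_update (x : Vecs d) (q : Fin p) (y : EuclideanSpace ℝ (Fin (d q)))
    (i : ∀ q, Fin (d q)) :
    rankOne (Function.update x q y) i = y (i q) * ∏ s ∈ Finset.univ.erase q, x s (i s) := by
  rw [rankOne, ← Finset.mul_prod_erase Finset.univ _ (Finset.mem_univ q)]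
  congr 1
  · simp
  · exact Finset.prod_congr rfl fun s hs => by
      rw [Function.update_of_ne (Finset.ne_of_mem_erase hs)]

theorem inner_contract (T : Tensor d) (q : Fin p) (x : Vecs d)
    (y : EuclideanSpace ℝ (Fin (d q))) :
    inner ℝ (contract T q x) y = pairing T (Function.update x q y) := by
  simp only [PiLp.inner_apply, contract, pairing, RCLike.inner_apply, conj_trivial,
    rankOne_update, Finset.mul_sum]
  rw [Finset.sum_comm]
  refine Finset.sum_congr rfl fun i _ => ?_
  rw [Finset.sum_eq_single (i q)]
  · simp
    ring
  · intro b _ hb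
    simp [Ne.symm hb]
  · simp

theorem tensorNorm_nonneg_of_unit (T : Tensor d) {x : Vecs d} (hx : ∀ q, ‖x q‖ = 1)
    (q : Fin p) : 0 ≤ tensorNorm T := by
  have h1 := pairing_le_tensorNorm T hx
  have hx' : ∀ s, ‖Function.update x q (-x q) s‖ = 1 := fun s => by
    by_cases h : s = q
    · subst h; simpa using hx s
    · rw [Function.update_of_ne h]; exact hx s
  have h2 := pairing_le_tensorNorm T hx'
  rw [← inner_contract, inner_neg_right, inner_contract, Function.update_eq_self] at h2
  linarith

theorem norm_contract_le_tensorNorm (T : Tensor d) {x : Vecs d} (hx : ∀ q, ‖x q‖ = 1)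
    (q : Fin p) : ‖contract T q x‖ ≤ tensorNorm T := by
  by_cases h0 : contract T q x = 0
  · rw [h0, norm_zero]; exact tensorNorm_nonneg_of_unit T hx q
  have hn : ‖contract T q x‖ ≠ 0 := norm_ne_zero_iff.2 h0
  set y := (‖contract T q x‖⁻¹ : ℝ) • contract T q x with hy
  have hx' : ∀ s, ‖Function.update x q y s‖ = 1 := fun s => by
    by_cases h : s = q
    · subst h
      rw [Function.update_self, hy, norm_smul, norm_inv, norm_norm, inv_mul_cancel₀ hn]
    · rw [Function.update_of_ne h]; exact hx s
  have h2 := pairing_le_tensorNorm T hx'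
  rw [← inner_contract, hy, inner_smul_right, real_inner_self_eq_norm_sq, pow_two,
    inv_mul_cancel_left₀ hn] at h2
  exact h2

theorem contract_sub (T T' : Tensor d) (q : Fin p) (x : Vecs d) :
    contract (T' - T) q x = contract T' q x - contract T q x := by
  ext a
  simp [contract, pairing, sub_mul]

/-- The contractions of `T` and `T'` with unit vectors differ by at most `ε`. -/
def CloseBy (ε : ℝ) (T T' : Tensor d) : Prop :=
  ∀ (q : Fin p) (x : Vecs d), (∀ s, ‖x s‖ = 1) → ‖contract T' q x - contract T q x‖ ≤ ε

theorem CloseBy.symm {ε : ℝ} {T T' : Tensor d} (h : CloseBy ε T T') : CloseBy ε T' T :=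
  fun q x hx => by rw [norm_sub_rev]; exact h q x hx

theorem closeBy_tensorNorm (T T' : Tensor d) : CloseBy (tensorNorm (T' - T)) T T' :=
  fun q x hx => by rw [← contract_sub]; exact norm_contract_le_tensorNorm _ hx q

/-- Each entry is a pairing with standard basis vectors. This disposes of the unperturbed case, so
that `ε > 0` can be assumed afterwards. -/
theorem eq_of_tensorNorm_sub_eq_zero {T T' : Tensor d} (hp : 0 < p)
    (h : tensorNorm (T' - T) = 0) : T' = T := by
  rw [← sub_eq_zero]
  funext i
  let q : Fin p := ⟨0, hp⟩
  let x : Vecs d := fun s => EuclideanSpace.single (i s) 1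
  have hx : ∀ s, ‖x s‖ = 1 := fun s => by simp [x]
  have h1 := norm_contract_le_tensorNorm (T' - T) hx q
  rw [h] at h1
  have h2 : contract (T' - T) q x = 0 := norm_le_zero_iff.1 h1
  have h3 := inner_contract (T' - T) q x (x q)
  rw [h2, inner_zero_left, Function.update_eq_self, pairing, Finset.sum_eq_single i] at h3
  · simpa [rankOne, x] using h3.symm
  · intro j _ hj
    obtain ⟨s, hs⟩ := Function.ne_iff.1 hj
    rw [rankOne, Finset.prod_eq_zero (Finset.mem_univ s), mul_zero]
    simp [x, hs]
  · simp

/-- The matrix of contractions acts as the corresponding linear combination. -/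
theorem norm_sum_smul_contract_le (E : Tensor d) {r : ℕ} (hr : r ≤ minDim d)
    (u : ∀ q, Fin (minDim d) → EuclideanSpace ℝ (Fin (d q))) (q : Fin p)
    (c : Fin (minDim d) → ℝ) (hc : ∀ k : Fin (minDim d), r ≤ (k : ℕ) → c k = 0) :
    ‖∑ k, c k • contract E q (fun s => u s k)‖ ≤
      matNorm (contractMatrix E hr u q) * √(∑ k, c k ^ 2) := by
  have himg : ∀ f : Fin (minDim d) → EuclideanSpace ℝ (Fin (d q)),
      (∀ k : Fin (minDim d), r ≤ (k : ℕ) → f k = 0) → ∑ k, f k = ∑ k : Fin r, f (Fin.castLE hr k) := by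
    intro f hf
    symm
    refine Finset.sum_of_injOn (Fin.castLE hr) (Fin.castLE_injective hr).injOn (by simp) ?_
      (by simp)
    intro k _ hk
    refine hf k ?_
    by_contra hlt
    exact hk ⟨⟨k, by omega⟩, by simp, by ext; simp⟩
  have hsq : ∑ k : Fin r, c (Fin.castLE hr k) ^ 2 ≤ ∑ k, c k ^ 2 := by
    have := Finset.sum_map Finset.univ (Fin.castLEEmb hr) (fun k => c k ^ 2)
    simp only [Fin.castLEEmb_apply] at this
    rw [← this]
    exact Finset.sum_le_sum_of_subset_of_nonneg (Finset.subset_univ _)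
      fun _ _ _ => sq_nonneg _
  have h := ((Matrix.toEuclideanLin (contractMatrix E hr u q)).toContinuousLinearMap).le_opNorm
    (WithLp.toLp 2 fun k => c (Fin.castLE hr k))
  have heq : (Matrix.toEuclideanLin (contractMatrix E hr u q)).toContinuousLinearMap
      (WithLp.toLp 2 fun k => c (Fin.castLE hr k)) =
      ∑ k, c k • contract E q (fun s => u s k) := by
    rw [himg _ fun k hk => by rw [hc k hk, zero_smul]]
    ext a
    simp [Matrix.toEuclideanLin, Matrix.mulVec, dotProduct, contractMatrix, mul_comm]
  rw [heq] at h
  refine h.trans ?_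
  rw [EuclideanSpace.norm_eq]
  simp only [Real.norm_eq_abs, sq_abs]
  exact mul_le_mul_of_nonneg_left (Real.sqrt_le_sqrt hsq) (norm_nonneg _)

end Contraction

/-! ### Elementary Hilbert space inequalities -/

section InnerProduct

variable {E : Type*} [NormedAddCommGroup E] [InnerProductSpace ℝ E]

/-- With `c = ⟨x, y⟩` the squared norm is both `α²(1 - c²) + (αc - β)²` and `(α - βc)² + β²(1 -
c²)`. Each claim keeps one summand. -/
theorem norm_smul_sub_smul_le {x y : E} (hx : ‖x‖ = 1) (hy : ‖y‖ = 1) {α β ε : ℝ}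
    (h : ‖α • x - β • y‖ ≤ ε) :
    α ^ 2 * (1 - inner ℝ x y ^ 2) ≤ ε ^ 2 ∧ |α - β * inner ℝ x y| ≤ ε := by
  have hε : 0 ≤ ε := (norm_nonneg _).trans h
  have h1 : ‖α • x - β • y‖ ^ 2 ≤ ε ^ 2 := pow_le_pow_left₀ (norm_nonneg _) h 2
  have h2 : ‖α • x - β • y‖ ^ 2 = α ^ 2 - 2 * (α * β * inner ℝ x y) + β ^ 2 := by
    rw [norm_sub_sq_real, norm_smul, norm_smul, hx, hy, inner_smul_left, inner_smul_right]
    simp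
    ring
  have hc : inner ℝ x y ^ 2 ≤ 1 := by
    have := abs_real_inner_le_norm x y
    rw [hx, hy, mul_one] at this
    exact (sq_le_one_iff_abs_le_one _).2 this
  rw [h2] at h1
  constructor
  · nlinarith [sq_nonneg (α * inner ℝ x y - β)]
  · refine abs_le_of_sq_le_sq ?_ hε
    nlinarith [mul_nonneg (sq_nonneg β) (sub_nonneg.2 hc)]

theorem norm_sum_smul_sq {ι : Type*} [Fintype ι] {w : ι → E} (hw : Orthonormal ℝ w)
    (s : Finset ι) (c : ι → ℝ) : ‖∑ i ∈ s, c i • w i‖ ^ 2 = ∑ i ∈ s, c i ^ 2 := by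
  rw [← real_inner_self_eq_norm_sq, hw.inner_sum]
  simp [pow_two]

theorem sum_inner_sq_le {ι : Type*} {w : ι → E} (hw : Orthonormal ℝ w)
    (s : Finset ι) {x : E} (hx : ‖x‖ = 1) : ∑ i ∈ s, inner ℝ (w i) x ^ 2 ≤ 1 := by
  have h := hw.sum_inner_products_le x (s := s)
  simpa [hx] using h

theorem inner_sq_add_inner_sq_le {ι : Type*} [DecidableEq ι] {w : ι → E}
    (hw : Orthonormal ℝ w) {i j : ι} (hij : i ≠ j) {x : E} (hx : ‖x‖ = 1) :
    inner ℝ (w i) x ^ 2 + inner ℝ (w j) x ^ 2 ≤ 1 := by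
  have h := sum_inner_sq_le hw {i, j} hx
  rwa [Finset.sum_pair hij] at h

end InnerProduct

/-! ### Partners of large components -/

section Matching

variable {p : ℕ} {d : Fin p → ℕ} {T T' : Tensor d} {lam lam' : Fin (minDim d) → ℝ}
  {u u' : ∀ q, Fin (minDim d) → EuclideanSpace ℝ (Fin (d q))} {ε : ℝ}

/-- The diagonal entries of `T'` contracted with `uₖ` in all modes but `a` and `b`. -/
noncomputable def pairCoeff (lam' : Fin (minDim d) → ℝ)
    (u' u : ∀ q, Fin (minDim d) → EuclideanSpace ℝ (Fin (d q))) (k : Fin (minDim d))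
    (a b : Fin p) (i : Fin (minDim d)) : ℝ :=
  lam' i * ∏ s ∈ (Finset.univ.erase a).erase b, inner ℝ (u' s i) (u s k)

theorem pairCoeff_comm (k : Fin (minDim d)) (a b : Fin p) (i : Fin (minDim d)) :
    pairCoeff lam' u' u k a b i = pairCoeff lam' u' u k b a i := by
  rw [pairCoeff, pairCoeff, Finset.erase_right_comm]

theorem pairCoeff_mul_inner {a b : Fin p} (hab : a ≠ b) (k i : Fin (minDim d)) :
    pairCoeff lam' u' u k a b i * inner ℝ (u' b i) (u b k) =
      lam' i * ∏ s ∈ Finset.univ.erase a, inner ℝ (u' s i) (u s k) := by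
  rw [pairCoeff, mul_assoc, Finset.prod_erase_mul]
  exact Finset.mem_erase.2 ⟨hab.symm, Finset.mem_univ b⟩

theorem contract_self (h : IsSVD T lam u) (q : Fin p) (h2 : 2 ≤ p) (k : Fin (minDim d)) :
    contract T q (fun s => u s k) = lam k • u q k := by
  rw [contract_svd h, Finset.sum_eq_single k]
  · rw [Finset.prod_eq_one, mul_one]
    intro s _
    rw [real_inner_self_eq_norm_sq, (h.orthonormal s).1 k, one_pow]
  · intro i _ hi
    obtain ⟨b, hb⟩ : ∃ b, b ≠ q := by
      have : Nontrivial (Fin p) := Fin.nontrivial_iff_two_le.2 h2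
      exact exists_ne q
    rw [Finset.prod_eq_zero (Finset.mem_erase.2 ⟨hb, Finset.mem_univ b⟩), mul_zero, zero_smul]
    exact (h.orthonormal b).2 hi
  · simp

/-- Orthonormality in mode `b` kills every component except the `i`-th. -/
theorem contract_update (h : IsSVD T lam u) {a b : Fin p} (hab : a ≠ b) (x : Vecs d)
    (i : Fin (minDim d)) :
    contract T a (Function.update x b (u b i)) =
      (lam i * ∏ s ∈ (Finset.univ.erase a).erase b, inner ℝ (u s i) (x s)) • u a i := by
  have hb : b ∈ (Finset.univ.erase a : Finset (Fin p)) :=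
    Finset.mem_erase.2 ⟨hab.symm, Finset.mem_univ b⟩
  rw [contract_svd h, Finset.sum_eq_single i]
  · rw [← Finset.mul_prod_erase _ _ hb, Function.update_self, real_inner_self_eq_norm_sq,
      (h.orthonormal b).1 i, one_pow, one_mul]
    congr 2
    exact Finset.prod_congr rfl fun s hs => by
      rw [Function.update_of_ne (Finset.ne_of_mem_erase hs)]
  · intro j _ hj
    rw [Finset.prod_eq_zero hb, mul_zero, zero_smul]
    rw [Function.update_self]
    exact (h.orthonormal b).2 hj
  · simp

theorem exists_ne_ne (hp : 3 ≤ p) (a b : Fin p) : ∃ s, s ≠ b ∧ s ≠ a := by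
  have h1 := Finset.pred_card_le_card_erase (s := (Finset.univ.erase a : Finset (Fin p))) (a := b)
  rw [Finset.card_erase_of_mem (Finset.mem_univ a), Finset.card_univ, Fintype.card_fin] at h1
  obtain ⟨s, hs⟩ := Finset.card_pos.1 (show 0 < ((Finset.univ.erase a).erase b).card by omega)
  exact ⟨s, by simpa using hs⟩

/-- Both tensors are contracted with `u s k`, except for `u' b i` in mode `b`. This isolates
component `i` of `T'`. It also isolates component `k` of `T`, because `p ≥ 3` leaves a third mode
still carrying `u s k`. -/
theorem norm_pairCoeff_smul_sub_le (h : IsSVD T lam u) (h' : IsSVD T' lam' u')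
    (hp : 3 ≤ p) (hc : CloseBy ε T T') {a b : Fin p} (hab : a ≠ b) (k i : Fin (minDim d)) :
    ‖pairCoeff lam' u' u k a b i • u' a i - (lam k * inner ℝ (u' b i) (u b k)) • u a k‖ ≤ ε := by
  have hx : ∀ s, ‖Function.update (fun s => u s k) b (u' b i) s‖ = 1 := fun s => by
    by_cases hs : s = b
    · subst hs; simpa using (h'.orthonormal s).1 i
    · rw [Function.update_of_ne hs]; exact (h.orthonormal s).1 k
  have h1 := hc a _ hx
  rw [contract_update h' hab] at h1
  convert h1 using 2
  rw [pairCoeff]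
  congr 1
  have hb : b ∈ (Finset.univ.erase a : Finset (Fin p)) :=
    Finset.mem_erase.2 ⟨hab.symm, Finset.mem_univ b⟩
  rw [contract_svd h, Finset.sum_eq_single k]
  · rw [← Finset.mul_prod_erase _ _ hb, Function.update_self, Finset.prod_eq_one, mul_one,
      real_inner_comm]
    intro s hs
    rw [Function.update_of_ne (Finset.ne_of_mem_erase hs), real_inner_self_eq_norm_sq,
      (h.orthonormal s).1 k, one_pow]
  · intro j _ hj
    obtain ⟨s, hsb, hsa⟩ := exists_ne_ne hp a b
    rw [Finset.prod_eq_zero (i := s) (by simp [hsa]), mul_zero, zero_smul]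
    rw [Function.update_of_ne hsb]
    exact (h.orthonormal s).2 hj
  · simp

/-- Contracting `T'` with `u s k` in all modes but `a` gives a vector of norm at least `lam k - ε`.
By Bessel in mode `b`, its norm is at most the largest diagonal entry. -/
theorem exists_pairCoeff_ge (h : IsSVD T lam u) (h' : IsSVD T' lam' u')
    (hp : 3 ≤ p) (hc : CloseBy ε T T') {a b : Fin p} (hab : a ≠ b) (k : Fin (minDim d)) :
    ∃ j, lam k - ε ≤ |pairCoeff lam' u' u k a b j| := by
  set m := pairCoeff lam' u' u k a b with hm
  obtain ⟨j, -, hj⟩ := Finset.exists_max_image Finset.univ (fun i => |m i|) ⟨k, Finset.mem_univ k⟩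
  refine ⟨j, ?_⟩
  have h1 := hc a (fun s => u s k) fun s => (h.orthonormal s).1 k
  rw [contract_self h a (by omega), contract_svd h'] at h1
  have h2 : lam k - ε ≤ ‖∑ i, (m i * inner ℝ (u' b i) (u b k)) • u' a i‖ := by
    simp only [hm, pairCoeff_mul_inner hab]
    have h3 := norm_sub_norm_le (lam k • u a k)
      (∑ i, (lam' i * ∏ s ∈ Finset.univ.erase a, inner ℝ (u' s i) (u s k)) • u' a i)
    rw [norm_smul, (h.orthonormal a).1 k, mul_one, Real.norm_eq_abs, abs_of_nonneg (h.nonneg k),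
      norm_sub_rev] at h3
    linarith
  refine h2.trans (abs_le_of_sq_le_sq' ?_ (abs_nonneg _)).2
  rw [norm_sum_smul_sq (h'.orthonormal a)]
  calc ∑ i, (m i * inner ℝ (u' b i) (u b k)) ^ 2
      ≤ ∑ i, |m j| ^ 2 * inner ℝ (u' b i) (u b k) ^ 2 := by
        refine Finset.sum_le_sum fun i hi => ?_
        rw [mul_pow, ← sq_abs (m i)]
        exact mul_le_mul_of_nonneg_right (pow_le_pow_left₀ (abs_nonneg _) (hj i hi) 2)
          (sq_nonneg _)
    _ ≤ |m j| ^ 2 := by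
        rw [← Finset.mul_sum]
        exact mul_le_of_le_one_right (sq_nonneg _)
          (sum_inner_sq_le (h'.orthonormal b) _ ((h.orthonormal b).1 k))

theorem eq_of_half_lt_inner_sq (h' : IsSVD T' lam' u') {q : Fin p}
    {x : EuclideanSpace ℝ (Fin (d q))} (hx : ‖x‖ = 1) {i j : Fin (minDim d)}
    (hi : 1 / 2 < inner ℝ (u' q i) x ^ 2) (hj : 1 / 2 < inner ℝ (u' q j) x ^ 2) : i = j := by
  by_contra hij
  linarith [inner_sq_add_inner_sq_le (h'.orthonormal q) hij hx]

theorem half_lt_of_sq_mul_le {l c : ℝ} (hl : 0 < l) (hε0 : 0 ≤ ε) (hε : 4 * ε ≤ l)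
    (h : l ^ 2 * (1 - c ^ 2) ≤ 4 * ε ^ 2) : 1 / 2 < c ^ 2 := by
  by_contra hcon
  nlinarith [mul_pos hl hl, mul_self_le_mul_self (by positivity) hε]

/-- `j` is the index of the component of `T'` close to the `k`-th component of `T`. -/
structure Matches (ε : ℝ) (lam lam' : Fin (minDim d) → ℝ)
    (u u' : ∀ q, Fin (minDim d) → EuclideanSpace ℝ (Fin (d q))) (k j : Fin (minDim d)) :
    Prop where
  angle : ∀ q, lam k ^ 2 * (1 - inner ℝ (u' q j) (u q k) ^ 2) ≤ 4 * ε ^ 2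
  le_coeff : ∀ a b, a ≠ b → lam k - ε ≤ |pairCoeff lam' u' u k a b j|
  coeff_sub_le : ∀ a b, a ≠ b → |pairCoeff lam' u' u k a b j -
    lam k * (inner ℝ (u' a j) (u a k) * inner ℝ (u' b j) (u b k))| ≤ ε

/-- The dominant diagonal entry could depend on the pair of modes. But it forces a squared cosine
above `1/2` in both modes, and Bessel allows only one such index per mode, so all pairs agree. -/
theorem exists_matches (h : IsSVD T lam u) (h' : IsSVD T' lam' u')
    (hp : 3 ≤ p) (hε0 : 0 ≤ ε) (hc : CloseBy ε T T') {k : Fin (minDim d)} (hk : 0 < lam k)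
    (hε : 4 * ε ≤ lam k) : ∃ j, Matches ε lam lam' u u' k j := by
  have hang : ∀ a b, a ≠ b → ∀ j, lam k - ε ≤ |pairCoeff lam' u' u k a b j| →
      lam k ^ 2 * (1 - inner ℝ (u' a j) (u a k) ^ 2) ≤ 4 * ε ^ 2 := fun a b hab j hj => by
    have h1 := (norm_smul_sub_smul_le ((h'.orthonormal a).1 j) ((h.orthonormal a).1 k)
      (norm_pairCoeff_smul_sub_le h h' hp hc hab k j)).1
    have h2 : (lam k / 2) ^ 2 ≤ pairCoeff lam' u' u k a b j ^ 2 := by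
      rw [← sq_abs (pairCoeff _ _ _ _ _ _ _)]
      exact pow_le_pow_left₀ (by positivity) (by linarith) 2
    have h3 : inner ℝ (u' a j) (u a k) ^ 2 ≤ 1 := by
      have := sum_inner_sq_le (h'.orthonormal a) {j} ((h.orthonormal a).1 k)
      simpa using this
    nlinarith [mul_le_mul_of_nonneg_right h2 (sub_nonneg.2 h3)]
  have hcomm : ∀ a b j, lam k - ε ≤ |pairCoeff lam' u' u k a b j| →
      lam k - ε ≤ |pairCoeff lam' u' u k b a j| := fun a b j hj => by
    rwa [pairCoeff_comm]
  have huniq : ∀ a i j, lam k ^ 2 * (1 - inner ℝ (u' a i) (u a k) ^ 2) ≤ 4 * ε ^ 2 →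
      lam k ^ 2 * (1 - inner ℝ (u' a j) (u a k) ^ 2) ≤ 4 * ε ^ 2 → i = j :=
    fun a i j hi hj => eq_of_half_lt_inner_sq h' ((h.orthonormal a).1 k)
      (half_lt_of_sq_mul_le hk hε0 hε hi) (half_lt_of_sq_mul_le hk hε0 hε hj)
  have hex : ∀ a b : Fin p, a ≠ b → ∃ j, lam k - ε ≤ |pairCoeff lam' u' u k a b j| :=
    fun a b hab => exists_pairCoeff_ge h h' hp hc hab k
  let q₀ : Fin p := ⟨0, by omega⟩
  let q₁ : Fin p := ⟨1, by omega⟩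
  have h01 : q₀ ≠ q₁ := by simp [q₀, q₁]
  obtain ⟨j, hj⟩ := hex q₀ q₁ h01
  have hj0 := hang q₀ q₁ h01 j hj
  have hjq : ∀ q, lam k ^ 2 * (1 - inner ℝ (u' q j) (u q k) ^ 2) ≤ 4 * ε ^ 2 := fun q => by
    by_cases hq : q₀ = q
    · exact hq ▸ hj0
    · obtain ⟨i, hi⟩ := hex q₀ q hq
      rw [huniq q₀ j i hj0 (hang q₀ q hq i hi)]
      exact hang q q₀ (Ne.symm hq) i (hcomm _ _ _ hi)
  refine ⟨j, hjq, fun a b hab => ?_, fun a b hab => ?_⟩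
  · obtain ⟨i, hi⟩ := hex a b hab
    rwa [huniq a j i (hjq a) (hang a b hab i hi)]
  · have h1 := (norm_smul_sub_smul_le ((h'.orthonormal a).1 j) ((h.orthonormal a).1 k)
      (norm_pairCoeff_smul_sub_le h h' hp hc hab k j)).2
    convert h1 using 3
    ring

theorem Matches.half_lt {k j : Fin (minDim d)} (hm : Matches ε lam lam' u u' k j)
    (hk : 0 < lam k) (hε0 : 0 ≤ ε) (hε : 4 * ε ≤ lam k) (q : Fin p) :
    1 / 2 < inner ℝ (u' q j) (u q k) ^ 2 :=
  half_lt_of_sq_mul_le hk hε0 hε (hm.angle q)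

theorem inner_sq_le_one (h : IsSVD T lam u) (h' : IsSVD T' lam' u') (q : Fin p)
    (i k : Fin (minDim d)) : inner ℝ (u' q i) (u q k) ^ 2 ≤ 1 := by
  simpa using sum_inner_sq_le (h'.orthonormal q) {i} ((h.orthonormal q).1 k)

theorem abs_inner_le_one (h : IsSVD T lam u) (h' : IsSVD T' lam' u') (q : Fin p)
    (i k : Fin (minDim d)) : |inner ℝ (u' q i) (u q k)| ≤ 1 :=
  (sq_le_one_iff_abs_le_one _).1 (inner_sq_le_one h h' q i k)

theorem abs_pairCoeff_le (h : IsSVD T lam u) (h' : IsSVD T' lam' u') (a b : Fin p)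
    (i k : Fin (minDim d)) : |pairCoeff lam' u' u k a b i| ≤ lam' i := by
  rw [pairCoeff, abs_mul, abs_of_nonneg (h'.nonneg i), Finset.abs_prod]
  exact mul_le_of_le_one_right (h'.nonneg i)
    (Finset.prod_le_one (fun _ _ => abs_nonneg _) fun s _ => abs_inner_le_one h h' s i k)

theorem Matches.le_lam (h : IsSVD T lam u) (h' : IsSVD T' lam' u') (hp : 3 ≤ p)
    {k j : Fin (minDim d)} (hm : Matches ε lam lam' u u' k j) : lam k - ε ≤ lam' j :=
  (hm.le_coeff ⟨0, by omega⟩ ⟨1, by omega⟩ (by simp)).trans (abs_pairCoeff_le h h' _ _ _ _)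

theorem Matches.coeff_le (h : IsSVD T lam u) (h' : IsSVD T' lam' u')
    {k j : Fin (minDim d)} (hm : Matches ε lam lam' u u' k j) {a b : Fin p} (hab : a ≠ b) :
    |pairCoeff lam' u' u k a b j| ≤ lam k + ε := by
  have h1 := abs_sub_abs_le_abs_sub (pairCoeff lam' u' u k a b j)
    (lam k * (inner ℝ (u' a j) (u a k) * inner ℝ (u' b j) (u b k)))
  have h2 := hm.coeff_sub_le a b hab
  have h3 : |lam k * (inner ℝ (u' a j) (u a k) * inner ℝ (u' b j) (u b k))| ≤ lam k := by
    rw [abs_mul, abs_mul, abs_of_nonneg (h.nonneg k)]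
    exact mul_le_of_le_one_right (h.nonneg k) (mul_le_one₀ (abs_inner_le_one h h' a j k)
      (abs_nonneg _) (abs_inner_le_one h h' b j k))
  linarith

/-- The diagonal entry is `ε`-close to `lam k` times the product `y` of two cosines. If it did not
have the sign of `y`, its size would be at most `ε`, contradicting the lower bound `lam k - ε`.
Multiplying the entry by `y` gives `lam' j` times the full product. -/
theorem Matches.prod_pos (h' : IsSVD T' lam' u') (hp : 3 ≤ p)
    {k j : Fin (minDim d)} (hm : Matches ε lam lam' u u' k j) 
    (hk : 0 < lam k) (hε0 : 0 ≤ ε) (hε : 4 * ε ≤ lam k) :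
    0 < ∏ q, inner ℝ (u' q j) (u q k) := by
  let q₀ : Fin p := ⟨0, by omega⟩
  let q₁ : Fin p := ⟨1, by omega⟩
  have h01 : q₀ ≠ q₁ := by simp [q₀, q₁]
  have h1 := hm.le_coeff _ _ h01
  have h2 := hm.coeff_sub_le _ _ h01
  have h3 := hm.half_lt hk hε0 hε
  have h4 : pairCoeff lam' u' u k q₀ q₁ j *
      (inner ℝ (u' q₀ j) (u q₀ k) * inner ℝ (u' q₁ j) (u q₁ k)) =
      lam' j * ∏ q, inner ℝ (u' q j) (u q k) := by
    rw [← Finset.mul_prod_erase Finset.univ _ (Finset.mem_univ q₀), mul_comm (inner ℝ _ _),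
      ← mul_assoc, pairCoeff_mul_inner h01]
    ring
  refine pos_of_mul_pos_right ?_ (h'.nonneg j)
  rw [← h4]
  set x := pairCoeff lam' u' u k q₀ q₁ j
  set y := inner ℝ (u' q₀ j) (u q₀ k) * inner ℝ (u' q₁ j) (u q₁ k) with hy
  have hy2 : y ≠ 0 := fun h0 => by
    have := mul_pos (show (0:ℝ) < inner ℝ (u' q₀ j) (u q₀ k) ^ 2 by linarith [h3 q₀])
      (show (0:ℝ) < inner ℝ (u' q₁ j) (u q₁ k) ^ 2 by linarith [h3 q₁])
    rw [← mul_pow, ← hy, h0] at this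
    simp at this
  by_contra hcon
  rw [not_lt] at hcon
  have h5 : x ^ 2 ≤ (x - lam k * y) ^ 2 := by
    nlinarith [mul_nonneg hk.le (neg_nonneg.2 hcon), sq_nonneg (lam k * y)]
  have h6 := (sq_le_sq.1 h5).trans h2
  linarith

theorem Matches.injective (h : IsSVD T lam u) (hp : 3 ≤ p) (h' : IsSVD T' lam' u')
    (hε0 : 0 ≤ ε) {k k' j : Fin (minDim d)} (hk : 0 < lam k) (hε : 4 * ε ≤ lam k)
    (hk' : 0 < lam k') (hε' : 4 * ε ≤ lam k') (hm : Matches ε lam lam' u u' k j)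
    (hm' : Matches ε lam lam' u u' k' j) : k = k' := by
  have h1 := hm.half_lt hk hε0 hε ⟨0, by omega⟩
  have h2 := hm'.half_lt hk' hε0 hε' ⟨0, by omega⟩
  rw [real_inner_comm] at h1 h2
  exact eq_of_half_lt_inner_sq h ((h'.orthonormal _).1 j) h1 h2

/-- A large `lam' i` is no obstacle: component `i` of `T'` then has its own partner `k' ≠ k` in `T`,
by matching in the reverse direction. Being aligned with `k'`, it is nearly orthogonal to `u q k`,
the more so the larger `lam' i` is. -/
theorem Matches.lam_mul_abs_inner_le (h : IsSVD T lam u) (h' : IsSVD T' lam' u') (hp : 3 ≤ p)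
    (hε0 : 0 ≤ ε) (hc : CloseBy ε T T') {k j : Fin (minDim d)}
    (hm : Matches ε lam lam' u u' k j) (hk : 0 < lam k) (hε : 4 * ε ≤ lam k)
    {i : Fin (minDim d)} (hij : i ≠ j) (q : Fin p) :
    lam' i * |inner ℝ (u' q i) (u q k)| ≤ 4 * ε := by
  by_cases hi : lam' i ≤ 4 * ε
  · exact (mul_le_of_le_one_right (h'.nonneg i) (abs_inner_le_one h h' q i k)).trans hi
  rw [not_le] at hi
  have hi0 : 0 < lam' i := by linarith
  obtain ⟨k', hk'⟩ := exists_matches h' h hp hε0 hc.symm hi0 hi.le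
  have hne : k' ≠ k := by
    rintro rfl
    have h1 := hk'.half_lt hi0 hε0 hi.le q
    rw [real_inner_comm] at h1
    exact hij (eq_of_half_lt_inner_sq h' ((h.orthonormal q).1 k') h1 (hm.half_lt hk hε0 hε q))
  have h2 := inner_sq_add_inner_sq_le (h.orthonormal q) hne ((h'.orthonormal q).1 i)
  have h3 := hk'.angle q
  rw [real_inner_comm]
  refine (abs_le_of_sq_le_sq' (b := 4 * ε) ?_ (by positivity)).2
  rw [mul_pow, sq_abs]
  nlinarith [mul_le_mul_of_nonneg_left h2 (sq_nonneg (lam' i)), sq_nonneg ε]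

end Matching

/-! ### Dimension-free closeness of the matched orthonormal families -/

section Estimates

variable {p : ℕ} {d : Fin p → ℕ} {T T' : Tensor d} {lam lam' : Fin (minDim d) → ℝ}
  {u u' : ∀ q, Fin (minDim d) → EuclideanSpace ℝ (Fin (d q))} {ε δ L : ℝ}

theorem exists_matching (h : IsSVD T lam u) (h' : IsSVD T' lam' u') (hp : 3 ≤ p) (hε0 : 0 ≤ ε)
    (hc : CloseBy ε T T') (hL : 0 < L) (hε : 4 * ε ≤ L) :
    ∃ j : Fin (minDim d) → Fin (minDim d), Function.Injective j ∧
      ∀ k, L ≤ lam k → Matches ε lam lam' u u' k (j k) := by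
  classical
  have hex : ∀ k, ∃ j, L ≤ lam k → Matches ε lam lam' u u' k j := fun k => by
    by_cases hk : L ≤ lam k
    · obtain ⟨j, hj⟩ := exists_matches h h' hp hε0 hc (hL.trans_le hk) (hε.trans hk)
      exact ⟨j, fun _ => hj⟩
    · exact ⟨k, fun hk' => absurd hk' hk⟩
  choose f hf using hex
  -- The partner map is injective on the indices with `L ≤ lam k`. It is extended arbitrarily to a
  -- permutation, so that all of `u'` can be reindexed.
  obtain ⟨g, hg⟩ := Finset.exists_equiv_extend_of_card_eq
    (t := (Finset.univ : Finset (Fin (minDim d)))) (by simp)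
    (s := Finset.univ.filter fun k => L ≤ lam k) (f := f) (Finset.subset_univ _) (by
      intro k hk k' hk' hkk
      simp only [Finset.coe_filter, Finset.mem_univ, true_and, Set.mem_ofPred_eq] at hk hk'
      exact (hf k hk).injective h hp h' hε0 (hL.trans_le hk) (hε.trans hk) (hL.trans_le hk')
        (hε.trans hk') (hkk ▸ hf k' hk'))
  refine ⟨fun k => g k, Subtype.val_injective.comp g.injective, fun k hk => ?_⟩
  have := hf k hk
  rwa [← hg k (by simpa using hk)] at this

theorem Matches.one_sub_inner_sq_le {k j : Fin (minDim d)} (hm : Matches ε lam lam' u u' k j)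
    (hε0 : 0 ≤ ε) (hk : 0 < lam k) (hδ : ε ≤ δ * lam k) (q : Fin p) :
    1 - inner ℝ (u' q j) (u q k) ^ 2 ≤ 4 * δ ^ 2 := by
  have h1 := hm.angle q
  have h2 := pow_le_pow_left₀ hε0 hδ 2
  have h3 : lam k ^ 2 * (1 - inner ℝ (u' q j) (u q k) ^ 2) ≤ lam k ^ 2 * (4 * δ ^ 2) := by
    nlinarith
  exact le_of_mul_le_mul_left h3 (by positivity)

theorem Matches.one_sub_le_abs_inner (h : IsSVD T lam u) (h' : IsSVD T' lam' u')
    {k j : Fin (minDim d)} (hm : Matches ε lam lam' u u' k j)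
    (hε0 : 0 ≤ ε) (hk : 0 < lam k) (hδ : ε ≤ δ * lam k) (q : Fin p) :
    1 - 4 * δ ^ 2 ≤ |inner ℝ (u' q j) (u q k)| := by
  have h1 := hm.one_sub_inner_sq_le hε0 hk hδ q
  have h2 := abs_inner_le_one h h' q j k
  rw [← sq_abs] at h1
  nlinarith [abs_nonneg (inner ℝ (u' q j) (u q k))]

/-- The diagonal entry is at most `lam k + ε`, while its cosines are at least `1 - 4δ²` each. By
Bernoulli and `4pδ ≤ 1` their product is at least `1 - δ`. -/
theorem Matches.lam_le (h : IsSVD T lam u) (h' : IsSVD T' lam' u') (hp : 3 ≤ p)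
    {k j : Fin (minDim d)} (hm : Matches ε lam lam' u u' k j)
    (hε0 : 0 ≤ ε) (hk : 0 < lam k) (hδ0 : 0 ≤ δ) (hδ : ε ≤ δ * lam k) (hδp : 4 * p * δ ≤ 1) :
    lam' j ≤ (1 + 4 * δ) * lam k := by
  have hp' : (3 : ℝ) ≤ p := by exact_mod_cast hp
  let q₀ : Fin p := ⟨0, by omega⟩
  let q₁ : Fin p := ⟨1, by omega⟩
  have h01 : q₀ ≠ q₁ := by simp [q₀, q₁]
  have h1 := hm.coeff_le h h' h01
  rw [pairCoeff, abs_mul, abs_of_nonneg (h'.nonneg j), Finset.abs_prod] at h1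
  have hδ1 : δ ≤ 1 / 12 := by nlinarith
  have h2 : 1 - δ ≤ ∏ s ∈ (Finset.univ.erase q₀).erase q₁, |inner ℝ (u' s j) (u s k)| := by
    have h3 : (1 - 4 * δ ^ 2) ^ ((Finset.univ.erase q₀).erase q₁).card ≤
        ∏ s ∈ (Finset.univ.erase q₀).erase q₁, |inner ℝ (u' s j) (u s k)| := by
      rw [← Finset.prod_const]
      exact Finset.prod_le_prod (fun _ _ => by nlinarith)
        fun s _ => hm.one_sub_le_abs_inner h h' hε0 hk hδ s
    refine le_trans ?_ h3
    have h4 : ((Finset.univ.erase q₀).erase q₁).card ≤ p :=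
      (Finset.card_le_univ _).trans (by simp)
    have h5 : (((Finset.univ.erase q₀).erase q₁).card : ℝ) ≤ p := by exact_mod_cast h4
    have h6 := one_add_mul_le_pow (show (-2 : ℝ) ≤ -(4 * δ ^ 2) by nlinarith)
      ((Finset.univ.erase q₀).erase q₁).card
    rw [← sub_eq_add_neg 1 (4 * δ ^ 2)] at h6
    nlinarith [mul_le_mul_of_nonneg_right h5 (sq_nonneg δ), mul_le_mul_of_nonneg_left hδp hδ0]
  have h7 : lam' j * (1 - δ) ≤ (1 + δ) * lam k := by
    nlinarith [mul_le_mul_of_nonneg_left h2 (h'.nonneg j)]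
  have h8 : (1 + δ) * lam k ≤ (1 + 4 * δ) * lam k * (1 - δ) := by
    nlinarith [mul_nonneg (mul_nonneg hδ0 hk.le) (show 0 ≤ 2 - 4 * δ by linarith)]
  exact le_of_mul_le_mul_right (h7.trans h8) (by linarith)

theorem Matches.diag_bounds (h : IsSVD T lam u) (h' : IsSVD T' lam' u') (hp : 3 ≤ p)
    {k j : Fin (minDim d)} (hm : Matches ε lam lam' u u' k j)
    (hε0 : 0 ≤ ε) (hk : 0 < lam k) (hδ0 : 0 ≤ δ) (hδ : ε ≤ δ * lam k) (hδ1 : δ ≤ 1 / 4)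
    (q : Fin p) :
    |lam' j * |∏ s ∈ Finset.univ.erase q, inner ℝ (u' s j) (u s k)| - lam k| ≤
      2 * δ * lam k := by
  obtain ⟨b, hb, -⟩ := exists_ne_ne hp q q
  have h0 := congrArg abs (pairCoeff_mul_inner (lam' := lam') (u' := u') (u := u) hb.symm k j)
  rw [abs_mul, abs_mul (lam' j), abs_of_nonneg (h'.nonneg j)] at h0
  rw [← h0]
  have h1 := hm.coeff_le h h' hb.symm
  have h2 := hm.le_coeff q b hb.symm
  have h3 := hm.one_sub_le_abs_inner h h' hε0 hk hδ b
  have h4 := abs_inner_le_one h h' b j k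
  set x := |pairCoeff lam' u' u k q b j|
  set y := |inner ℝ (u' b j) (u b k)|
  have hx : 0 ≤ x := abs_nonneg _
  have h5 : x * y ≤ x := mul_le_of_le_one_right hx h4
  have h6 : ((1 - δ) * lam k) * (1 - 4 * δ ^ 2) ≤ x * y :=
    mul_le_mul (by linarith) h3 (by nlinarith) hx
  have h7 : (1 - 2 * δ) * lam k ≤ ((1 - δ) * lam k) * (1 - 4 * δ ^ 2) := by
    have : 0 ≤ lam k * δ * (1 - 4 * δ + 4 * δ ^ 2) :=
      mul_nonneg (mul_nonneg hk.le hδ0) (by nlinarith)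
    nlinarith
  rw [abs_le]
  constructor <;> nlinarith

/-- The `p - 1` modes share the work: `s₁` absorbs `lam' i` at cost `4ε`, `s₀` pays for the sum over
`i` by Bessel, and the other `p - 3` contribute `2δ` each. -/
theorem Matches.norm_offDiag_le (h : IsSVD T lam u) (h' : IsSVD T' lam' u') (hp : 3 ≤ p)
    (hε0 : 0 ≤ ε) (hc : CloseBy ε T T') {k j : Fin (minDim d)}
    (hm : Matches ε lam lam' u u' k j) (hk : 0 < lam k) (hε : 4 * ε ≤ lam k) (hδ0 : 0 ≤ δ)
    (hδ : ε ≤ δ * lam k) (q : Fin p) :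
    ‖∑ i ∈ Finset.univ.erase j,
      (lam' i * ∏ s ∈ Finset.univ.erase q, inner ℝ (u' s i) (u s k)) • u' q i‖ ≤
      4 * ε * (2 * δ) ^ (p - 2) := by
  refine (abs_le_of_sq_le_sq' ?_ (by positivity)).2
  rw [norm_sum_smul_sq (h'.orthonormal q)]
  obtain ⟨s₀, hs₀, -⟩ := exists_ne_ne hp q q
  obtain ⟨s₁, hs₁, hs₁q⟩ := exists_ne_ne hp q s₀
  have hmem0 : s₀ ∈ (Finset.univ.erase q : Finset (Fin p)) := by simp [hs₀]
  have hmem1 : s₁ ∈ ((Finset.univ.erase q).erase s₀ : Finset (Fin p)) := by simp [hs₁, hs₁q]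
  set R := ((Finset.univ.erase q).erase s₀).erase s₁ with hR
  have hcard : R.card = p - 3 := by
    rw [hR, Finset.card_erase_of_mem hmem1, Finset.card_erase_of_mem hmem0,
      Finset.card_erase_of_mem (Finset.mem_univ q), Finset.card_univ, Fintype.card_fin]
    omega
  have hsmall : ∀ s, ∑ i ∈ Finset.univ.erase j, inner ℝ (u' s i) (u s k) ^ 2 ≤ 4 * δ ^ 2 := by
    intro s
    have h1 := sum_inner_sq_le (h'.orthonormal s) Finset.univ ((h.orthonormal s).1 k)
    rw [← Finset.add_sum_erase _ _ (Finset.mem_univ j)] at h1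
    linarith [hm.one_sub_inner_sq_le hε0 hk hδ s]
  have hsmall1 : ∀ s, ∀ i ∈ Finset.univ.erase j, inner ℝ (u' s i) (u s k) ^ 2 ≤ 4 * δ ^ 2 :=
    fun s i hi => (Finset.single_le_sum (f := fun i => inner ℝ (u' s i) (u s k) ^ 2)
      (fun _ _ => sq_nonneg _) hi).trans (hsmall s)
  calc ∑ i ∈ Finset.univ.erase j,
        (lam' i * ∏ s ∈ Finset.univ.erase q, inner ℝ (u' s i) (u s k)) ^ 2
      ≤ ∑ i ∈ Finset.univ.erase j,
        inner ℝ (u' s₀ i) (u s₀ k) ^ 2 * ((4 * ε) ^ 2 * (4 * δ ^ 2) ^ (p - 3)) := by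
        refine Finset.sum_le_sum fun i hi => ?_
        rw [← Finset.mul_prod_erase _ _ hmem0, ← Finset.mul_prod_erase _ _ hmem1, ← hR]
        have h1 : (lam' i * inner ℝ (u' s₁ i) (u s₁ k)) ^ 2 ≤ (4 * ε) ^ 2 := by
          refine sq_le_sq' ?_ ?_ <;>
          · have := hm.lam_mul_abs_inner_le h h' hp hε0 hc hk hε (Finset.ne_of_mem_erase hi) s₁
            rw [← abs_of_nonneg (h'.nonneg i), ← abs_mul] at this
            have := abs_le.1 this
            linarith [this.1, this.2]
        have h2 : ∏ s ∈ R, inner ℝ (u' s i) (u s k) ^ 2 ≤ (4 * δ ^ 2) ^ (p - 3) := by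
          rw [← hcard, ← Finset.prod_const]
          exact Finset.prod_le_prod (fun _ _ => sq_nonneg _) fun s _ => hsmall1 s i hi
        calc _ = inner ℝ (u' s₀ i) (u s₀ k) ^ 2 * ((lam' i * inner ℝ (u' s₁ i) (u s₁ k)) ^ 2 *
              ∏ s ∈ R, inner ℝ (u' s i) (u s k) ^ 2) := by rw [Finset.prod_pow]; ring
          _ ≤ _ := by
            refine mul_le_mul_of_nonneg_left ?_ (sq_nonneg _)
            exact mul_le_mul h1 h2 (Finset.prod_nonneg fun _ _ => sq_nonneg _) (sq_nonneg _)
    _ ≤ (4 * δ ^ 2) * ((4 * ε) ^ 2 * (4 * δ ^ 2) ^ (p - 3)) := by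
        rw [← Finset.sum_mul]
        exact mul_le_mul_of_nonneg_right (hsmall s₀) (by positivity)
    _ = (4 * ε * (2 * δ) ^ (p - 2)) ^ 2 := by
        obtain ⟨m, rfl⟩ := Nat.exists_eq_add_of_le hp
        rw [show 3 + m - 3 = m by omega, show 3 + m - 2 = m + 1 by omega]
        rw [show 4 * δ ^ 2 = (2 * δ) ^ 2 by ring]
        generalize 2 * δ = x
        ring

/-- The sign `±1` of a real number, with `0` counted as positive. -/
noncomputable def alignSign (x : ℝ) : ℝ := if 0 ≤ x then 1 else -1

theorem alignSign_mul_self (x : ℝ) : alignSign x * alignSign x = 1 := by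
  unfold alignSign; split_ifs <;> norm_num

theorem alignSign_mul (x : ℝ) : alignSign x * x = |x| := by
  unfold alignSign
  split_ifs with hx
  · rw [one_mul, abs_of_nonneg hx]
  · rw [abs_of_neg (not_le.1 hx), neg_one_mul]

theorem eq_abs_mul_alignSign {x y : ℝ} (h : 0 < x * y) : y = |y| * alignSign x := by
  unfold alignSign
  rcases pos_and_pos_or_neg_and_neg_of_mul_pos h with ⟨hx, hy⟩ | ⟨hx, hy⟩
  · rw [if_pos hx.le, abs_of_pos hy, mul_one]
  · rw [if_neg (not_le.2 hx), abs_of_neg hy]; ring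

/-- The vectors of `u'`, reindexed by `j` and with signs adapted to `u`. -/
noncomputable def aligned (u u' : ∀ q, Fin (minDim d) → EuclideanSpace ℝ (Fin (d q)))
    (j : Fin (minDim d) → Fin (minDim d)) (q : Fin p) (k : Fin (minDim d)) :
    EuclideanSpace ℝ (Fin (d q)) :=
  alignSign (inner ℝ (u' q (j k)) (u q k)) • u' q (j k)

theorem orthonormal_aligned (h' : IsSVD T' lam' u') {j : Fin (minDim d) → Fin (minDim d)}
    (hj : Function.Injective j) (q : Fin p) : Orthonormal ℝ (aligned u u' j q) := by
  constructor
  · intro k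
    rw [aligned, norm_smul, (h'.orthonormal q).1, mul_one, alignSign]
    split_ifs <;> simp
  · intro k k' hk
    simp only [aligned, inner_smul_left, inner_smul_right]
    rw [(h'.orthonormal q).2 (hj.ne hk)]
    simp

theorem Matches.exists_expansion (h : IsSVD T lam u) (h' : IsSVD T' lam' u') (hp : 3 ≤ p)
    (hε0 : 0 ≤ ε) (hc : CloseBy ε T T') {j : Fin (minDim d) → Fin (minDim d)}
    {k : Fin (minDim d)} (hm : Matches ε lam lam' u u' k (j k)) (hk : 0 < lam k) (hδ0 : 0 ≤ δ)
    (hδ : ε ≤ δ * lam k) (hδ1 : δ ≤ 1 / 4) (q : Fin p) :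
    ∃ γ : ℝ, |γ| ≤ 2 * δ ∧
      ‖lam k • (u q k - aligned u u' j q k) + contract (T' - T) q (fun s => u s k) -
        (lam k * γ) • aligned u u' j q k‖ ≤ 4 * ε * (2 * δ) ^ (p - 2) := by
  have hε : 4 * ε ≤ lam k := by nlinarith
  set P := ∏ s ∈ Finset.univ.erase q, inner ℝ (u' s (j k)) (u s k) with hP
  have hb := hm.diag_bounds h h' hp hε0 hk hδ0 hδ hδ1 q
  rw [← hP] at hb
  refine ⟨(lam' (j k) * |P| - lam k) / lam k, ?_, ?_⟩
  · rw [abs_div, abs_of_pos hk, div_le_iff₀ hk]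
    exact hb
  · have hPP : P = |P| * alignSign (inner ℝ (u' q (j k)) (u q k)) := by
      refine eq_abs_mul_alignSign ?_
      rw [hP, Finset.mul_prod_erase _ (fun s => inner ℝ (u' s (j k)) (u s k)) (Finset.mem_univ q)]
      exact hm.prod_pos h' hp hk hε0 hε
    have hrem := hm.norm_offDiag_le h h' hp hε0 hc hk hε hδ0 hδ q
    convert hrem using 2
    rw [contract_sub, contract_self h q (by omega), contract_svd h',
      ← Finset.add_sum_erase _ _ (Finset.mem_univ (j k)), ← hP, mul_div_cancel₀ _ hk.ne']
    have h3 : (lam' (j k) * P) • u' q (j k) = (lam' (j k) * |P|) • aligned u u' j q k := by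
      rw [aligned, smul_smul, mul_assoc, ← hPP]
    rw [h3]
    module

theorem norm_sum_smul_eq_sqrt {E : Type*} [NormedAddCommGroup E] [InnerProductSpace ℝ E]
    {ι : Type*} [Fintype ι] {w : ι → E} (hw : Orthonormal ℝ w) (c : ι → ℝ) :
    ‖∑ i, c i • w i‖ = √(∑ i, c i ^ 2) := by
  rw [← norm_sum_smul_sq hw, Real.sqrt_sq (norm_nonneg _)]

theorem sum_abs_le_sqrt_mul_sqrt {n r : ℕ} (c : Fin n → ℝ)
    (hc : ∀ k : Fin n, r ≤ (k : ℕ) → c k = 0) : ∑ k, |c k| ≤ √r * √(∑ k, c k ^ 2) := by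
  rw [← Real.sqrt_mul (Nat.cast_nonneg r)]
  refine Real.le_sqrt_of_sq_le ?_
  have h1 : ∑ k, |c k| = ∑ k ∈ Finset.univ.filter (fun k : Fin n => (k : ℕ) < r), |c k| := by
    rw [Finset.sum_filter]
    refine Finset.sum_congr rfl fun k _ => ?_
    split_ifs with hk
    · rfl
    · rw [hc k (not_lt.1 hk), abs_zero]
  have hcard : (Finset.univ.filter (fun k : Fin n => (k : ℕ) < r)).card ≤ r := by
    have := Finset.card_le_card_of_injOn (s := Finset.univ.filter (fun k : Fin n => (k : ℕ) < r))
      (t := Finset.range r) (fun k => (k : ℕ)) (by intro k; simp) Fin.val_injective.injOn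
    simpa using this
  rw [h1]
  refine sq_sum_le_card_mul_sum_sq.trans ?_
  simp only [sq_abs]
  refine mul_le_mul (by exact_mod_cast hcard) ?_ (Finset.sum_nonneg fun _ _ => sq_nonneg _)
    (Nat.cast_nonneg r)
  exact Finset.sum_le_sum_of_subset_of_nonneg (Finset.subset_univ _) fun _ _ _ => sq_nonneg _

theorem norm_sum_smul_sub_aligned_le (h : IsSVD T lam u) (h' : IsSVD T' lam' u') (hp : 3 ≤ p)
    (hε0 : 0 ≤ ε) (hc : CloseBy ε T T') {j : Fin (minDim d) → Fin (minDim d)}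
    (hj : Function.Injective j) (hm : ∀ k, L ≤ lam k → Matches ε lam lam' u u' k (j k))
    (hL : 0 < L) (hδ0 : 0 ≤ δ) (hδ : ε ≤ δ * L) (hδ1 : δ ≤ 1 / 4)
    {r : ℕ} (hr : r ≤ minDim d) (hlam : ∀ k : Fin (minDim d), 0 < lam k ↔ (k : ℕ) < r)
    {C₁ B : ℝ} (hC₁ : 0 ≤ C₁) (q : Fin p)
    (hM : matNorm (contractMatrix (T' - T) hr u q) ≤ C₁ * ε)
    (hB : √r * δ ^ (p - 2) ≤ B) (c : Fin (minDim d) → ℝ) (hcL : ∀ k, c k ≠ 0 → L ≤ lam k) :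
    ‖∑ k, c k • (u q k - aligned u u' j q k)‖ ≤
      (C₁ + 2 + 4 * 2 ^ (p - 2) * B) * δ * √(∑ k, c k ^ 2) := by
  have hex : ∀ k, ∃ γ : ℝ, |γ| ≤ 2 * δ ∧ (L ≤ lam k →
      ‖lam k • (u q k - aligned u u' j q k) + contract (T' - T) q (fun s => u s k) -
        (lam k * γ) • aligned u u' j q k‖ ≤ 4 * ε * (2 * δ) ^ (p - 2)) := fun k => by
    by_cases hk : L ≤ lam k
    · obtain ⟨γ, h1, h2⟩ := (hm k hk).exists_expansion h h' hp hε0 hc (hL.trans_le hk) hδ0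
        (hδ.trans (mul_le_mul_of_nonneg_left hk hδ0)) hδ1 q
      exact ⟨γ, h1, fun _ => h2⟩
    · exact ⟨0, by simpa using hδ0, fun hk' => absurd hk' hk⟩
  choose γ hγ hexp using hex
  set N := √(∑ k, c k ^ 2) with hN
  have hN0 : 0 ≤ N := Real.sqrt_nonneg _
  set R : Fin (minDim d) → EuclideanSpace ℝ (Fin (d q)) := fun k =>
    lam k • (u q k - aligned u u' j q k) + contract (T' - T) q (fun s => u s k) -
        (lam k * γ k) • aligned u u' j q k with hR
  have hdiv : ∀ k, |c k / lam k| ≤ |c k| / L := fun k => by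
    by_cases hk : c k = 0
    · simp [hk]
    · rw [abs_div, abs_of_pos (hL.trans_le (hcL k hk))]
      exact div_le_div_of_nonneg_left (abs_nonneg _) hL (hcL k hk)
  -- The expansions, divided by `lam k` and summed. Dividing costs at most `1 / L`, as `c` is
  -- supported where `L ≤ lam k`.
  have hdecomp : ∑ k, c k • (u q k - aligned u u' j q k) =
      -(∑ k, (c k / lam k) • contract (T' - T) q (fun s => u s k)) +
      ∑ k, (c k * γ k) • aligned u u' j q k + ∑ k, (c k / lam k) • R k := by
    rw [← Finset.sum_neg_distrib, ← Finset.sum_add_distrib, ← Finset.sum_add_distrib]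
    refine Finset.sum_congr rfl fun k _ => ?_
    by_cases hk : c k = 0
    · simp [hk]
    · have hlk : lam k ≠ 0 := (hL.trans_le (hcL k hk)).ne'
      have h1 : c k = c k / lam k * lam k := by field_simp
      rw [hR]
      nth_rewrite 1 [h1]
      nth_rewrite 3 [h1]
      module
  have hsqrt : ∀ (f : Fin (minDim d) → ℝ) (K : ℝ), 0 ≤ K → (∀ k, |f k| ≤ K * |c k|) →
      √(∑ k, f k ^ 2) ≤ K * N := fun f K hK hf => by
    rw [hN, ← Real.sqrt_sq hK, ← Real.sqrt_mul (sq_nonneg K), Finset.mul_sum]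
    refine Real.sqrt_le_sqrt (Finset.sum_le_sum fun k _ => ?_)
    rw [← mul_pow, ← sq_abs (f k), ← sq_abs (K * c k), abs_mul, abs_of_nonneg hK]
    exact pow_le_pow_left₀ (abs_nonneg _) (hf k) 2
  have hzero : ∀ k : Fin (minDim d), r ≤ (k : ℕ) → c k = 0 := fun k hk => by
    by_contra hck
    exact absurd ((hlam k).1 (hL.trans_le (hcL k hck))) (not_lt.2 hk)
  have hεL : ε / L ≤ δ := (div_le_iff₀ hL).2 hδ
  have h1 : ‖∑ k, (c k / lam k) • contract (T' - T) q (fun s => u s k)‖ ≤ C₁ * δ * N := by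
    refine (norm_sum_smul_contract_le (T' - T) hr u q _ fun k hk => by
      rw [hzero k hk, zero_div]).trans ?_
    have h2 := hsqrt (fun k => c k / lam k) L⁻¹ (inv_nonneg.2 hL.le) fun k => by
      rw [inv_mul_eq_div]; exact hdiv k
    calc _ ≤ (C₁ * ε) * (L⁻¹ * N) :=
          mul_le_mul hM h2 (Real.sqrt_nonneg _) (mul_nonneg hC₁ hε0)
      _ = C₁ * (ε / L) * N := by ring
      _ ≤ _ := by gcongr
  have h2 : ‖∑ k, (c k * γ k) • aligned u u' j q k‖ ≤ 2 * δ * N := by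
    rw [norm_sum_smul_eq_sqrt (orthonormal_aligned h' hj q)]
    refine hsqrt _ _ (by positivity) fun k => ?_
    rw [abs_mul, mul_comm]
    exact mul_le_mul_of_nonneg_right (hγ k) (abs_nonneg _)
  -- The remainders have no joint structure: the triangle inequality and Cauchy–Schwarz cost `√r`,
  -- paid for by the factor `δ ^ (p - 2)`.
  have h3 : ‖∑ k, (c k / lam k) • R k‖ ≤ 4 * 2 ^ (p - 2) * B * δ * N := by
    calc _ ≤ ∑ k, |c k| / L * (4 * ε * (2 * δ) ^ (p - 2)) := by
          refine norm_sum_le_of_le _ fun k _ => ?_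
          by_cases hk : c k = 0
          · simp [hk]
          · rw [norm_smul, Real.norm_eq_abs]
            exact mul_le_mul (hdiv k) (hexp k (hcL k hk)) (norm_nonneg _)
              (div_nonneg (abs_nonneg _) hL.le)
      _ = (∑ k, |c k|) * (ε / L * (4 * (2 * δ) ^ (p - 2))) := by
          rw [Finset.sum_mul]
          exact Finset.sum_congr rfl fun k _ => by ring
      _ ≤ (√r * N) * (δ * (4 * (2 * δ) ^ (p - 2))) := by
          have := sum_abs_le_sqrt_mul_sqrt c hzero
          gcongr
      _ = 4 * 2 ^ (p - 2) * (√r * δ ^ (p - 2)) * δ * N := by rw [mul_pow]; ring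
      _ ≤ _ := by gcongr
  rw [hdecomp]
  refine (norm_add₃_le).trans ?_
  rw [norm_neg]
  linarith

end Estimates

/-! ### Rescaling the coefficients -/

section Rescale

theorem abs_sub_one_le_abs_pow_sub_one {t : ℝ} (ht : 0 ≤ t) {m : ℕ} (hm : m ≠ 0) :
    |t - 1| ≤ |t ^ m - 1| := by
  rcases le_total 1 t with h | h
  · have := le_self_pow₀ h hm
    rw [abs_of_nonneg (by linarith), abs_of_nonneg (by linarith)]
    linarith
  · have := pow_le_of_le_one ht h hm
    rw [abs_of_nonpos (by linarith), abs_of_nonpos (by linarith)]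
    linarith

/-- Take `t k` proportional to `ρ k ^ (-1/m)` and normalize. Since both coefficient vectors are unit
vectors, some active `t k` is at least 1 and some is at most 1. This traps `τ = ρ k * t k ^ m`
between `1 - x` and `1 + x`, and then every `t k`. -/
theorem exists_rescale {n m : ℕ} (hm : m ≠ 0) (α ρ : Fin n → ℝ) (hα : ∑ k, α k ^ 2 = 1) {x : ℝ}
    (hx0 : 0 ≤ x) (hx : x ≤ 1 / 2) (hρ : ∀ k, α k ≠ 0 → |ρ k - 1| ≤ x) :
    ∃ (t : Fin n → ℝ) (τ : ℝ), |τ - 1| ≤ x ∧ (∀ k, α k ≠ 0 → τ = ρ k * t k ^ m) ∧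
      (∑ k, (t k * α k) ^ 2 = 1) ∧ ∀ k, |t k - 1| ≤ 4 * x := by
  classical
  have hρ0 : ∀ k, α k ≠ 0 → 0 < ρ k := fun k hk => by
    have := (abs_le.1 (hρ k hk)).1
    linarith
  set σ : Fin n → ℝ := fun k => (ρ k)⁻¹ ^ ((m : ℝ)⁻¹) with hσ
  have hσpow : ∀ k, α k ≠ 0 → σ k ^ m = (ρ k)⁻¹ := fun k hk =>
    Real.rpow_inv_natCast_pow (inv_pos.2 (hρ0 k hk)).le hm
  have hσpos : ∀ k, α k ≠ 0 → 0 < σ k := fun k hk => Real.rpow_pos_of_pos (inv_pos.2 (hρ0 k hk)) _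
  obtain ⟨k₀, hk₀⟩ : ∃ k, α k ≠ 0 := by
    by_contra hcon
    push Not at hcon
    simp [hcon] at hα
  set S := ∑ k, (σ k * α k) ^ 2 with hS
  have hS0 : 0 < S := Finset.sum_pos' (fun _ _ => sq_nonneg _)
    ⟨k₀, Finset.mem_univ _, by have := hσpos k₀ hk₀; positivity⟩
  set κ := (√S)⁻¹ with hκ
  have hκ0 : 0 < κ := inv_pos.2 (Real.sqrt_pos.2 hS0)
  set t : Fin n → ℝ := fun k => if α k = 0 then 1 else κ * σ k with ht
  have htpos : ∀ k, 0 < t k := fun k => by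
    simp only [ht]
    split_ifs with hk
    · exact one_pos
    · exact mul_pos hκ0 (hσpos k hk)
  have hτ : ∀ k, α k ≠ 0 → κ ^ m = ρ k * t k ^ m := fun k hk => by
    simp only [ht, if_neg hk, mul_pow, hσpow k hk]
    field_simp [(hρ0 k hk).ne']
  have hsum : ∑ k, (t k * α k) ^ 2 = 1 := by
    have : ∀ k, (t k * α k) ^ 2 = κ ^ 2 * (σ k * α k) ^ 2 := fun k => by
      by_cases hk : α k = 0
      · simp [hk]
      · simp only [ht, if_neg hk]; ring
    simp only [this]
    rw [← Finset.mul_sum, ← hS, hκ, inv_pow, Real.sq_sqrt hS0.le, inv_mul_cancel₀ hS0.ne']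
  have hge : ∃ k, α k ≠ 0 ∧ 1 ≤ t k := by
    by_contra hcon
    push Not at hcon
    have : ∑ k, (t k * α k) ^ 2 < ∑ k, α k ^ 2 := by
      refine Finset.sum_lt_sum (fun k _ => ?_) ⟨k₀, Finset.mem_univ _, ?_⟩
      · by_cases hk : α k = 0
        · simp [hk]
        · rw [mul_pow]
          exact mul_le_of_le_one_left (sq_nonneg _) (pow_le_one₀ (htpos k).le (hcon k hk).le)
      · rw [mul_pow]
        exact mul_lt_of_lt_one_left (by positivity)
          (pow_lt_one₀ (htpos k₀).le (hcon k₀ hk₀) two_ne_zero)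
    linarith
  have hle : ∃ k, α k ≠ 0 ∧ t k ≤ 1 := by
    by_contra hcon
    push Not at hcon
    have : ∑ k, α k ^ 2 < ∑ k, (t k * α k) ^ 2 := by
      refine Finset.sum_lt_sum (fun k _ => ?_) ⟨k₀, Finset.mem_univ _, ?_⟩
      · by_cases hk : α k = 0
        · simp [hk]
        · rw [mul_pow]
          exact le_mul_of_one_le_left (sq_nonneg _) (one_le_pow₀ (hcon k hk).le)
      · rw [mul_pow]
        exact lt_mul_of_one_lt_left (by positivity) (one_lt_pow₀ (hcon k₀ hk₀) two_ne_zero)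
    linarith
  have hτ1 : 1 - x ≤ κ ^ m := by
    obtain ⟨k, hk, htk⟩ := hge
    rw [hτ k hk]
    have h1 := (abs_le.1 (hρ k hk)).1
    have h2 := le_mul_of_one_le_right (hρ0 k hk).le (one_le_pow₀ htk (n := m))
    linarith
  have hτ2 : κ ^ m ≤ 1 + x := by
    obtain ⟨k, hk, htk⟩ := hle
    rw [hτ k hk]
    have h1 := (abs_le.1 (hρ k hk)).2
    have h2 := mul_le_of_le_one_right (hρ0 k hk).le (pow_le_one₀ (htpos k).le htk (n := m))
    linarith
  refine ⟨t, κ ^ m, abs_le.2 ⟨by linarith, by linarith⟩, hτ, hsum, fun k => ?_⟩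
  by_cases hk : α k = 0
  · simp [ht, hk, hx0]
  · refine (abs_sub_one_le_abs_pow_sub_one (htpos k).le hm).trans ?_
    have h1 := hτ k hk
    have h2 := abs_le.1 (hρ k hk)
    have h3 := hρ0 k hk
    rw [h1] at hτ1 hτ2
    refine abs_le.2 ⟨?_, ?_⟩
    · by_contra hcon
      have : ρ k * (t k ^ m) ≤ ρ k * (1 - 4 * x) := mul_le_mul_of_nonneg_left (by linarith) h3.le
      nlinarith
    · by_contra hcon
      have : ρ k * (1 + 4 * x) < ρ k * (t k ^ m) := mul_lt_mul_of_pos_left (by linarith) h3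
      nlinarith

end Rescale

/-! ### Moving the orthogonal component -/

section Orthogonal

variable {E : Type*} [NormedAddCommGroup E] [InnerProductSpace ℝ E]

theorem norm_sum_smul_add_sq {ι : Type*} [Fintype ι] {w : ι → E} (hw : Orthonormal ℝ w)
    (c : ι → ℝ) {y : E} (hy : ∀ k, inner ℝ (w k) y = 0) :
    ‖∑ k, c k • w k + y‖ ^ 2 = ∑ k, c k ^ 2 + ‖y‖ ^ 2 := by
  have h0 : inner ℝ (∑ k, c k • w k) y = 0 := by
    simp [sum_inner, inner_smul_left, hy]
  rw [norm_add_sq_real, h0, norm_sum_smul_sq hw]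
  ring

/-- If two orthonormal families are close, then a vector orthogonal to the first one is close to
a vector of the same norm orthogonal to the second one. -/
theorem exists_orthogonal_near {ι : Type*} [Fintype ι] {u w : ι → E} (hw : Orthonormal ℝ w)
    {η : ℝ} (hη0 : 0 ≤ η) (hη : η ≤ 1 / 2)
    (hclose : ∀ c : ι → ℝ, ‖∑ k, c k • (u k - w k)‖ ≤ η * √(∑ k, c k ^ 2)) {x : E}
    (hx : ∀ k, inner ℝ (u k) x = 0) :
    ∃ y, (∀ k, inner ℝ (w k) y = 0) ∧ ‖y‖ = ‖x‖ ∧ ‖x - y‖ ≤ 2 * η * ‖x‖ := by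
  by_cases hx0 : x = 0
  · exact ⟨0, by simp, by simp [hx0], by simp [hx0]⟩
  set c : ι → ℝ := fun k => inner ℝ (w k) x with hc
  set P := ∑ k, c k • w k with hP
  have hPn : ‖P‖ = √(∑ k, c k ^ 2) := by
    rw [← norm_sum_smul_sq hw, Real.sqrt_sq (norm_nonneg _)]
  have hPx : inner ℝ P x = ‖P‖ ^ 2 := by
    rw [hP, norm_sum_smul_sq hw, sum_inner]
    exact Finset.sum_congr rfl fun k _ => by rw [inner_smul_left, hc]; simp [pow_two]
  -- As `x` is orthogonal to every `u k`, the product `⟨P, x⟩ = ‖P‖²` is unchanged when `w k` is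
  -- replaced by `w k - u k`.
  have hPle : ‖P‖ ≤ η * ‖x‖ := by
    have h1 : inner ℝ P x = -inner ℝ (∑ k, c k • (u k - w k)) x := by
      rw [hP, sum_inner, sum_inner, ← Finset.sum_neg_distrib]
      refine Finset.sum_congr rfl fun k _ => ?_
      rw [inner_smul_left, inner_smul_left, inner_sub_left, hx k]
      ring
    have h2 : ‖P‖ ^ 2 ≤ η * ‖P‖ * ‖x‖ := by
      rw [← hPx, h1]
      refine (neg_le_abs _).trans ((abs_real_inner_le_norm _ _).trans ?_)
      refine mul_le_mul_of_nonneg_right ?_ (norm_nonneg _)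
      rw [hPn]
      exact hclose c
    rcases (norm_nonneg P).eq_or_lt with h0 | h0
    · rw [← h0]; positivity
    · refine le_of_mul_le_mul_left ?_ h0
      linarith
  set z := x - P with hz
  have hxn : 0 < ‖x‖ := norm_pos_iff.2 hx0
  have hxz : |‖x‖ - ‖z‖| ≤ η * ‖x‖ := by
    refine (abs_norm_sub_norm_le _ _).trans ?_
    rw [hz, sub_sub_cancel]
    exact hPle
  have hzn : 0 < ‖z‖ := by
    have := (abs_le.1 hxz).2
    nlinarith
  refine ⟨(‖x‖ / ‖z‖) • z, fun k => ?_, ?_, ?_⟩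
  · rw [inner_smul_right, hz, inner_sub_right, hP, hw.inner_right_fintype, hc, sub_self, mul_zero]
  · rw [norm_smul, Real.norm_eq_abs, abs_of_nonneg (by positivity), div_mul_cancel₀ _ hzn.ne']
  · have h1 : x - (‖x‖ / ‖z‖) • z = P + ((‖z‖ - ‖x‖) / ‖z‖) • z := by
      rw [sub_div, div_self hzn.ne', sub_smul, one_smul]
      rw [hz]
      abel
    rw [h1]
    refine (norm_add_le _ _).trans ?_
    rw [norm_smul, Real.norm_eq_abs, abs_div, abs_of_pos hzn, div_mul_cancel₀ _ hzn.ne', abs_sub_comm]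
    linarith

end Orthogonal

/-! ### Transporting a singular tuple to the perturbed tensor -/

section Construction

variable {p : ℕ} {d : Fin p → ℕ} {T T' : Tensor d} {lam lam' : Fin (minDim d) → ℝ}
  {u u' : ∀ q, Fin (minDim d) → EuclideanSpace ℝ (Fin (d q))} {ε δ L : ℝ}

theorem IsSingularTuple.mul_inner (h : IsSVD T lam u) {l : ℝ} {v : Vecs d}
    (hv : IsSingularTuple T l v) (q : Fin p) (k : Fin (minDim d)) :
    l * inner ℝ (u q k) (v q) = lam k * ∏ s ∈ Finset.univ.erase q, inner ℝ (u s k) (v s) := by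
  have h1 := congrArg (fun w => inner ℝ (u q k) w) (hv.2 q)
  simp only [contract_svd h, (h.orthonormal q).inner_right_fintype, inner_smul_right] at h1
  exact h1.symm

theorem IsSingularTuple.smul_sub_sum (h : IsSVD T lam u) {l : ℝ} {v : Vecs d}
    (hv : IsSingularTuple T l v) (q : Fin p) :
    l • (v q - ∑ k, (inner ℝ (u q k) (v q) : ℝ) • u q k) = 0 := by
  rw [smul_sub, ← hv.2 q, contract_svd h, Finset.smul_sum, sub_eq_zero]
  exact Finset.sum_congr rfl fun k _ => by rw [smul_smul, hv.mul_inner h]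

/-- By `Matches.prod_pos` the signs over all modes multiply to 1, so the aligned vectors represent
the same rank-one term of `T'`. -/
theorem Matches.prod_alignSign (h' : IsSVD T' lam' u') (hp : 3 ≤ p)
    {k j : Fin (minDim d)} (hm : Matches ε lam lam' u u' k j)
    (hk : 0 < lam k) (hε0 : 0 ≤ ε) (hε : 4 * ε ≤ lam k) (q : Fin p) :
    ∏ s ∈ Finset.univ.erase q, alignSign (inner ℝ (u' s j) (u s k)) =
      alignSign (inner ℝ (u' q j) (u q k)) := by
  have hpos := hm.prod_pos h' hp hk hε0 hε
  rw [← Finset.mul_prod_erase _ _ (Finset.mem_univ q)] at hpos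
  have h1 := eq_abs_mul_alignSign hpos
  set P := ∏ s ∈ Finset.univ.erase q, inner ℝ (u' s j) (u s k) with hP
  set σ := alignSign (inner ℝ (u' q j) (u q k)) with hσ
  have hP0 : |P| ≠ 0 := fun h0 => by rw [abs_eq_zero.1 h0, mul_zero] at hpos; exact hpos.false
  have h2 : (∏ s ∈ Finset.univ.erase q, alignSign (inner ℝ (u' s j) (u s k))) * P = |P| := by
    rw [hP, ← Finset.prod_mul_distrib, Finset.abs_prod]
    exact Finset.prod_congr rfl fun s _ => alignSign_mul _
  set Q := ∏ s ∈ Finset.univ.erase q, alignSign (inner ℝ (u' s j) (u s k))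
  have h3 : |P| * (Q * σ) = |P| * 1 := by
    rw [h1] at h2
    rw [abs_mul, abs_abs] at h2
    have : |σ| = 1 := by rw [hσ, alignSign]; split_ifs <;> simp
    rw [this] at h2
    linarith
  have h4 := mul_left_cancel₀ hP0 h3
  calc Q = Q * (σ * σ) := by rw [hσ, alignSign_mul_self, mul_one]
    _ = σ := by rw [← mul_assoc, h4, one_mul]

/-- A singular tuple of `T'` from the rescaled coefficients of a tuple of `T`. -/
theorem exists_singularTuple_near (h : IsSVD T lam u) (h' : IsSVD T' lam' u') (hp : 3 ≤ p)
    (hε0 : 0 ≤ ε) {j : Fin (minDim d) → Fin (minDim d)}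
    (hj : Function.Injective j) (hm : ∀ k, L ≤ lam k → Matches ε lam lam' u u' k (j k))
    (hL : 0 < L) (hε : 4 * ε ≤ L) {v : Vecs d} (hv : ∀ q, ‖v q‖ = 1)
    {η ξ : ℝ} (hη0 : 0 ≤ η) (hη : η ≤ 1 / 2)
    (hclose : ∀ q, ∀ c : Fin (minDim d) → ℝ, (∀ k, c k ≠ 0 → L ≤ lam k) →
      ‖∑ k, c k • (u q k - aligned u u' j q k)‖ ≤ η * √(∑ k, c k ^ 2))
    (hact : ∀ q k, inner ℝ (u q k) (v q) ≠ 0 → L ≤ lam k)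
    (hspan : (∀ q, v q - ∑ k, (inner ℝ (u q k) (v q) : ℝ) • u q k = 0) ∨ ∀ k, L ≤ lam k)
    (t : Fin (minDim d) → ℝ) (hξ : 0 ≤ ξ) (ht : ∀ k, |t k - 1| ≤ ξ) {l' : ℝ}
    (hl' : ∀ q k, l' * (t k * inner ℝ (u q k) (v q)) =
      lam' (j k) * ∏ s ∈ Finset.univ.erase q, (t k * inner ℝ (u s k) (v s)))
    (hnorm : ∀ q, ∑ k, (t k * inner ℝ (u q k) (v q)) ^ 2 = ∑ k, inner ℝ (u q k) (v q) ^ 2)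
    (hl0 : l' = 0 ∨ ∀ q, v q - ∑ k, (inner ℝ (u q k) (v q) : ℝ) • u q k = 0) :
    ∃ v' : Vecs d, IsSingularTuple T' l' v' ∧ ∀ q, ‖v q - v' q‖ ≤ 3 * η + ξ := by
  set a : ∀ q, Fin (minDim d) → ℝ := fun q k => inner ℝ (u q k) (v q) with ha
  set w := aligned u u' j with hw
  have hwo : ∀ q, Orthonormal ℝ (w q) := fun q => orthonormal_aligned h' hj q
  set x : Vecs d := fun q => v q - ∑ k, a q k • u q k with hx
  have hxu : ∀ q k, inner ℝ (u q k) (x q) = 0 := fun q k => by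
    rw [hx, inner_sub_right, (h.orthonormal q).inner_right_fintype, ha, sub_self]
  have hvx : ∀ q, v q = ∑ k, a q k • u q k + x q :=
    fun q => (add_sub_cancel _ _).symm
  have hsq : ∀ q, ∑ k, a q k ^ 2 + ‖x q‖ ^ 2 = 1 := fun q => by
    rw [← norm_sum_smul_add_sq (h.orthonormal q) _ (hxu q), ← hvx, hv q, one_pow]
  have hxn : ∀ q, ‖x q‖ ≤ 1 := fun q => by
    have h1 := hsq q
    have h2 : 0 ≤ ∑ k, a q k ^ 2 := Finset.sum_nonneg fun _ _ => sq_nonneg _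
    exact (sq_le_one_iff₀ (norm_nonneg _)).1 (by linarith)
  have hsqrt : ∀ q, √(∑ k, a q k ^ 2) ≤ 1 := fun q => by
    rw [Real.sqrt_le_one]
    nlinarith [hsq q, sq_nonneg ‖x q‖]
  -- A nonzero orthogonal part occurs only when every `lam k` is at least `L`. Then `hclose` holds
  -- for all coefficients, as `exists_orthogonal_near` needs.
  have hy : ∀ q, ∃ y, (∀ k, inner ℝ (w q k) y = 0) ∧ ‖y‖ = ‖x q‖ ∧ ‖x q - y‖ ≤ 2 * η * ‖x q‖ ∧
      (x q = 0 → y = 0) := fun q => by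
    rcases hspan with h0 | hall
    · exact ⟨0, by simp, by rw [show x q = 0 from h0 q], by simp [show x q = 0 from h0 q],
        fun _ => rfl⟩
    · obtain ⟨y, h1, h2, h3⟩ := exists_orthogonal_near (hwo q) hη0 hη
        (fun c => hclose q c fun k _ => hall k) (hxu q)
      exact ⟨y, h1, h2, h3, fun h0 => norm_eq_zero.1 (by rw [h2, h0, norm_zero])⟩
  choose y hyw hyn hyx hy0 using hy
  refine ⟨fun q => ∑ k, (t k * a q k) • w q k + y q, ⟨fun q => ?_, fun q => ?_⟩, fun q => ?_⟩
  · rw [← pow_left_inj₀ (norm_nonneg _) zero_le_one two_ne_zero,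
      norm_sum_smul_add_sq (hwo q) _ (hyw q), hyn, one_pow, ← hsq q]
    congr 1
    exact hnorm q
  · set v' : Vecs d := fun q => ∑ k, (t k * a q k) • w q k + y q with hv'
    have hin : ∀ s k, inner ℝ (u' s (j k)) (v' s) =
        alignSign (inner ℝ (u' s (j k)) (u s k)) * (t k * a s k) := fun s k => by
      have h1 : u' s (j k) = alignSign (inner ℝ (u' s (j k)) (u s k)) • w s k := by
        rw [hw, aligned, smul_smul, alignSign_mul_self, one_smul]
      have h2 : inner ℝ (w s k) (v' s) = t k * a s k := by
        rw [hv', inner_add_right, (hwo s).inner_right_fintype, hyw, add_zero]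
      nth_rewrite 1 [h1]
      rw [inner_smul_left, h2]
      simp
    rw [contract_svd h', ← hj.bijective_of_finite.sum_comp]
    have hly : l' • y q = 0 := by
      rcases hl0 with h0 | h0
      · rw [h0, zero_smul]
      · rw [hy0 q (h0 q), smul_zero]
    rw [smul_add, hly, add_zero, Finset.smul_sum]
    refine Finset.sum_congr rfl fun k _ => ?_
    simp only [hin]
    rw [smul_smul, hl' q k, Finset.prod_mul_distrib]
    by_cases hk : L ≤ lam k
    · rw [(hm k hk).prod_alignSign h' hp (hL.trans_le hk) hε0 (hε.trans hk), hw, aligned, smul_smul]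
      congr 1
      ring
    -- Below the threshold the index has no genuine partner, but its coefficients vanish in all
    -- modes.
    · obtain ⟨b, hb, -⟩ := exists_ne_ne hp q q
      have h0 : ∏ s ∈ Finset.univ.erase q, (t k * a s k) = 0 := by
        refine Finset.prod_eq_zero (Finset.mem_erase.2 ⟨hb, Finset.mem_univ b⟩) ?_
        rw [show a b k = 0 from by_contra fun h0 => hk (hact b k h0), mul_zero]
      rw [h0]
      simp
  · have h1 : v q - (∑ k, (t k * a q k) • w q k + y q) =
        ∑ k, a q k • (u q k - w q k) + ∑ k, ((1 - t k) * a q k) • w q k + (x q - y q) := by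
      rw [hvx q, add_sub_add_comm, ← Finset.sum_sub_distrib, ← Finset.sum_add_distrib]
      congr 1
      exact Finset.sum_congr rfl fun k _ => by module
    rw [h1]
    refine norm_add₃_le.trans ?_
    have h2 := (hclose q (a q) fun k hk => hact q k hk).trans
      (mul_le_of_le_one_right hη0 (hsqrt q))
    have h3 : ‖∑ k, ((1 - t k) * a q k) • w q k‖ ≤ ξ := by
      rw [norm_sum_smul_eq_sqrt (hwo q)]
      calc _ ≤ √(ξ ^ 2 * ∑ k, a q k ^ 2) := by
            rw [Finset.mul_sum]
            refine Real.sqrt_le_sqrt (Finset.sum_le_sum fun k _ => ?_)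
            rw [mul_pow]
            refine mul_le_mul_of_nonneg_right ?_ (sq_nonneg _)
            rw [← sq_abs, abs_sub_comm]
            exact pow_le_pow_left₀ (abs_nonneg _) (ht k) 2
        _ = ξ * √(∑ k, a q k ^ 2) := by rw [Real.sqrt_mul (sq_nonneg _), Real.sqrt_sq hξ]
        _ ≤ ξ := mul_le_of_le_one_right hξ (hsqrt q)
    have h4 : ‖x q - y q‖ ≤ 2 * η :=
      (hyx q).trans (mul_le_of_le_one_right (by positivity) (hxn q))
    linarith

end Construction

/-! ### Small and large relative perturbations -/

section Perturbation

variable {p : ℕ} {d : Fin p → ℕ} {T T' : Tensor d} {lam lam' : Fin (minDim d) → ℝ}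
  {u u' : ∀ q, Fin (minDim d) → EuclideanSpace ℝ (Fin (d q))} {ε δ L : ℝ}

theorem isSingularTuple_self (h : IsSVD T lam u) (hp : 3 ≤ p) (k : Fin (minDim d)) :
    IsSingularTuple T (lam k) (fun q => u q k) :=
  ⟨fun q => (h.orthonormal q).1 k, fun q => contract_self h q (by omega) k⟩

theorem IsSingularTuple.sub_sum_eq_zero (h : IsSVD T lam u) {l : ℝ} {v : Vecs d}
    (hv : IsSingularTuple T l v) (hl : l ≠ 0) (q : Fin p) :
    v q - ∑ k, (inner ℝ (u q k) (v q) : ℝ) • u q k = 0 :=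
  (smul_eq_zero.1 (hv.smul_sub_sum h q)).resolve_left hl

theorem IsSingularTuple.sum_inner_sq (h : IsSVD T lam u) {l : ℝ} {v : Vecs d}
    (hv : IsSingularTuple T l v) (hl : l ≠ 0) (q : Fin p) :
    ∑ k, inner ℝ (u q k) (v q) ^ 2 = 1 := by
  rw [← norm_sum_smul_sq (h.orthonormal q), ← sub_eq_zero.1 (hv.sub_sum_eq_zero h hl q), hv.1 q,
    one_pow]

theorem IsSingularTuple.inner_sq_eq (h : IsSVD T lam u) {l : ℝ} {v : Vecs d}
    (hv : IsSingularTuple T l v) (hl : l ≠ 0) (q q' : Fin p) (k : Fin (minDim d)) :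
    inner ℝ (u q k) (v q) ^ 2 = inner ℝ (u q' k) (v q') ^ 2 := by
  have h1 : ∀ q, l * inner ℝ (u q k) (v q) ^ 2 = lam k * ∏ s, inner ℝ (u s k) (v s) := fun q => by
    rw [pow_two, ← mul_assoc, hv.mul_inner h, ← Finset.prod_erase_mul _ _ (Finset.mem_univ q)]
    ring
  exact mul_left_cancel₀ hl ((h1 q).trans (h1 q').symm)

theorem IsSingularTuple.abs_inner_eq (h : IsSVD T lam u) {l : ℝ} {v : Vecs d}
    (hv : IsSingularTuple T l v) (hl : l ≠ 0) (q q' : Fin p) (k : Fin (minDim d)) :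
    |(inner ℝ (u q k) (v q) : ℝ)| = |(inner ℝ (u q' k) (v q') : ℝ)| :=
  (sq_eq_sq_iff_abs_eq_abs _ _).1 (hv.inner_sq_eq h hl q q' k)

theorem IsSingularTuple.eq_lam_mul_pow (h : IsSVD T lam u) (hp : 3 ≤ p) {l : ℝ} {v : Vecs d}
    (hv : IsSingularTuple T l v) (hl : 0 < l) (q : Fin p) {k : Fin (minDim d)}
    (hk : inner ℝ (u q k) (v q) ≠ 0) :
    l = lam k * |(inner ℝ (u q k) (v q) : ℝ)| ^ (p - 2) := by
  have h1 := congrArg abs (hv.mul_inner h q k)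
  rw [abs_mul, abs_mul, abs_of_pos hl, abs_of_nonneg (h.nonneg k), Finset.abs_prod,
    Finset.prod_congr rfl fun s _ => hv.abs_inner_eq h hl.ne' s q k, Finset.prod_const,
    Finset.card_erase_of_mem (Finset.mem_univ q), Finset.card_univ, Fintype.card_fin,
    show p - 1 = (p - 2) + 1 by omega, pow_succ, ← mul_assoc] at h1
  exact mul_right_cancel₀ (abs_ne_zero.2 hk) h1

/-- A positive singular value is bounded below by the smallest active `λₖ`. -/
theorem IsSingularTuple.le_mul_sqrt_pow (h : IsSVD T lam u) (hp : 3 ≤ p) {l : ℝ} {v : Vecs d}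
    (hv : IsSingularTuple T l v) (hl : 0 < l) (hL : 0 < L) {r : ℕ}
    (hlam : ∀ k : Fin (minDim d), 0 < lam k ↔ (k : ℕ) < r)
    (hact : ∀ q k, inner ℝ (u q k) (v q) ≠ 0 → L ≤ lam k) :
    L ≤ l * √r ^ (p - 2) := by
  let q : Fin p := ⟨0, by omega⟩
  set a : Fin (minDim d) → ℝ := fun k => inner ℝ (u q k) (v q) with ha
  have hsum : ∑ k, a k ^ 2 = 1 := hv.sum_inner_sq h hl.ne' q
  have hne : (Finset.univ : Finset (Fin (minDim d))).Nonempty := by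
    by_contra hcon
    rw [Finset.not_nonempty_iff_eq_empty.1 hcon, Finset.sum_empty] at hsum
    exact zero_ne_one hsum
  obtain ⟨k, -, hk⟩ := Finset.exists_max_image Finset.univ (fun k => |a k|) hne
  have hzero : ∀ k : Fin (minDim d), r ≤ (k : ℕ) → a k = 0 := fun k hk => by
    by_contra hck
    exact absurd ((hlam k).1 (hL.trans_le (hact q k hck))) (not_lt.2 hk)
  -- The squares sum to 1 and at most `r` coefficients are nonzero, so the largest is at least `1 /
  -- √r`.
  have h1 : 1 ≤ |a k| * √r := by
    have h2 := sum_abs_le_sqrt_mul_sqrt a hzero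
    rw [hsum, Real.sqrt_one, mul_one] at h2
    calc 1 = ∑ i, |a i| * |a i| := by
          rw [← hsum]
          exact Finset.sum_congr rfl fun i _ => by rw [abs_mul_abs_self, pow_two]
      _ ≤ ∑ i, |a k| * |a i| := Finset.sum_le_sum fun i hi =>
          mul_le_mul_of_nonneg_right (hk i hi) (abs_nonneg _)
      _ ≤ _ := by
        rw [← Finset.mul_sum]
        exact mul_le_mul_of_nonneg_left h2 (abs_nonneg _)
  have hak : a k ≠ 0 := fun h0 => by rw [h0, abs_zero, zero_mul] at h1; linarith
  calc L ≤ lam k * 1 := by rw [mul_one]; exact hact q k hak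
    _ ≤ lam k * (|a k| * √r) ^ (p - 2) :=
        mul_le_mul_of_nonneg_left (one_le_pow₀ h1) (h.nonneg k)
    _ = l * √r ^ (p - 2) := by
        rw [mul_pow, ← mul_assoc, ← hv.eq_lam_mul_pow h hp hl q hak]

theorem exists_singularTuple_of_small (h : IsSVD T lam u) (h' : IsSVD T' lam' u') (hp : 3 ≤ p)
    (hε0 : 0 ≤ ε) (hc : CloseBy ε T T') (hL : 0 < L) (hδ0 : 0 ≤ δ) (hδ : ε ≤ δ * L)
    (hδp : 4 * p * δ ≤ 1) {r : ℕ} (hr : r ≤ minDim d)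
    (hlam : ∀ k : Fin (minDim d), 0 < lam k ↔ (k : ℕ) < r) {C₁ B K : ℝ} (hC₁ : 0 ≤ C₁)
    (hB0 : 0 ≤ B) (hM : ∀ q, matNorm (contractMatrix (T' - T) hr u q) ≤ C₁ * ε)
    (hB : √r * δ ^ (p - 2) ≤ B) (hK : K = C₁ + 2 + 4 * 2 ^ (p - 2) * B) (hKδ : K * δ ≤ 1 / 2)
    {l : ℝ} {v : Vecs d} (hv : IsSingularTuple T l v)
    (hact : ∀ q k, inner ℝ (u q k) (v q) ≠ 0 → L ≤ lam k)
    (hspan : (∀ q, v q - ∑ k, (inner ℝ (u q k) (v q) : ℝ) • u q k = 0) ∨ ∀ k, L ≤ lam k) :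
    ∃ (l' : ℝ) (v' : Vecs d), IsSingularTuple T' l' v' ∧
      (∀ q, ‖v q - v' q‖ ≤ (3 * K + 16) * δ) ∧ |l' - l| ≤ 4 * δ * |l| := by
  have hp' : (3 : ℝ) ≤ p := by exact_mod_cast hp
  have hδ1 : δ ≤ 1 / 12 := by nlinarith
  have hε : 4 * ε ≤ L := by nlinarith
  have hK0 : 0 ≤ K := by rw [hK]; positivity
  obtain ⟨j, hj, hm⟩ := exists_matching h h' hp hε0 hc hL hε
  have hclose : ∀ q, ∀ c : Fin (minDim d) → ℝ, (∀ k, c k ≠ 0 → L ≤ lam k) →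
      ‖∑ k, c k • (u q k - aligned u u' j q k)‖ ≤ K * δ * √(∑ k, c k ^ 2) := fun q c hcL => by
    rw [hK]
    exact norm_sum_smul_sub_aligned_le h h' hp hε0 hc hj hm hL hδ0 hδ (by linarith) hr hlam hC₁ q
      (hM q) hB c hcL
  have hcon := exists_singularTuple_near (ξ := 4 * (4 * δ)) h h' hp hε0 hj hm hL hε hv.1
    (mul_nonneg hK0 hδ0) hKδ hclose hact hspan
  by_cases hl : l = 0
  -- For `l = 0` the products of coefficients over `p - 1` modes vanish wherever `lam k > 0`. These
  -- equations do not involve `lam'`, so no rescaling is needed.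
  · obtain ⟨v', h1, h2⟩ := hcon (fun _ => 1) (by positivity)
      (fun k => by simpa using hδ0) (l' := 0) (fun q k => by
      rw [zero_mul]
      simp only [one_mul]
      by_cases hk : L ≤ lam k
      · have h1 := hv.mul_inner h q k
        rw [hl, zero_mul] at h1
        rw [(mul_eq_zero.1 h1.symm).resolve_left (hL.trans_le hk).ne', mul_zero]
      · obtain ⟨b, hb, -⟩ := exists_ne_ne hp q q
        rw [Finset.prod_eq_zero (Finset.mem_erase.2 ⟨hb, Finset.mem_univ b⟩), mul_zero]
        exact by_contra fun h0 => hk (hact b k h0)) (fun q => by simp) (Or.inl rfl)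
    refine ⟨0, v', h1, fun q => (h2 q).trans ?_, by simp [hl]⟩
    nlinarith
  · let q₀ : Fin p := ⟨0, by omega⟩
    have hρ : ∀ k, inner ℝ (u q₀ k) (v q₀) ≠ 0 → |lam' (j k) / lam k - 1| ≤ 4 * δ := fun k hk => by
      have hLk := hact q₀ k hk
      have hk0 := hL.trans_le hLk
      have hδk := hδ.trans (mul_le_mul_of_nonneg_left hLk hδ0)
      have h1 := (hm k hLk).lam_le h h' hp hε0 hk0 hδ0 hδk hδp
      have h2 := (hm k hLk).le_lam h h' hp
      rw [div_sub_one hk0.ne', abs_div, abs_of_pos hk0, div_le_iff₀ hk0, abs_le]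
      constructor <;> nlinarith
    obtain ⟨t, τ, hτ, hτt, hsum, ht⟩ := exists_rescale (m := p - 2) (by omega)
      (fun k => inner ℝ (u q₀ k) (v q₀)) (fun k => lam' (j k) / lam k)
      (hv.sum_inner_sq h hl q₀) (x := 4 * δ) (by positivity) (by linarith) hρ
    obtain ⟨v', h1, h2⟩ := hcon t (by positivity) ht (l' := τ * l)
      (fun q k => by
        by_cases hk : inner ℝ (u q₀ k) (v q₀) = 0
        · have hall : ∀ s, inner ℝ (u s k) (v s) = 0 := fun s => by
            have := hv.inner_sq_eq h hl s q₀ k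
            rw [hk, zero_pow two_ne_zero] at this
            exact pow_eq_zero_iff two_ne_zero |>.1 this
          obtain ⟨b, hb, -⟩ := exists_ne_ne hp q q
          rw [Finset.prod_eq_zero (Finset.mem_erase.2 ⟨hb, Finset.mem_univ b⟩)
            (by rw [hall b, mul_zero]), hall q, mul_zero, mul_zero, mul_zero]
        · have hk0 := hL.trans_le (hact q₀ k hk)
          rw [Finset.prod_mul_distrib, Finset.prod_const,
            Finset.card_erase_of_mem (Finset.mem_univ q), Finset.card_univ, Fintype.card_fin,
            show p - 1 = (p - 2) + 1 by omega, hτt k hk]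
          have h3 := hv.mul_inner h q k
          calc _ = lam' (j k) / lam k * t k ^ (p - 2) * t k *
                (l * inner ℝ (u q k) (v q)) := by ring
            _ = _ := by rw [h3, pow_succ]; field_simp)
      (fun q => by
        rw [hv.sum_inner_sq h hl q, ← hsum]
        exact Finset.sum_congr rfl fun k _ => by
          rw [mul_pow, mul_pow, hv.inner_sq_eq h hl q q₀])
      (Or.inr (hv.sub_sum_eq_zero h hl))
    refine ⟨τ * l, v', h1, fun q => (h2 q).trans (by linarith), ?_⟩
    rw [← sub_one_mul, abs_mul]
    exact mul_le_mul_of_nonneg_right hτ (abs_nonneg _)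

/-- If `λₖ` is of the order of the perturbation, then so is some `λ'ᵢ`. -/
theorem exists_lam_le (h : IsSVD T lam u) (h' : IsSVD T' lam' u') (hp : 3 ≤ p)
    (hε0 : 0 < ε) (hc : CloseBy ε T T') {c K : ℝ} (hK : 4 ≤ K)
    (hcK : 1 ≤ (K - 1) * c) {k : Fin (minDim d)} (hk : c * lam k < ε) :
    ∃ i, lam' i ≤ K * ε := by
  by_contra hcon
  push Not at hcon
  -- If all `lam' i` exceeded `K * ε`, the reverse matching would be a bijection onto the components
  -- of `T`, making every `lam k` exceed `(K - 1) * ε`.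
  obtain ⟨j, hj, hm⟩ := exists_matching h' h hp hε0.le hc.symm
    (show 0 < K * ε by positivity) (by nlinarith)
  obtain ⟨i, hi⟩ := hj.bijective_of_finite.surjective k
  have h1 := (hm i (hcon i).le).le_lam h' h hp
  rw [hi] at h1
  have h2 := hcon i
  have h3 : (K - 1) * (c * lam k) < (K - 1) * ε := mul_lt_mul_of_pos_left hk (by linarith)
  nlinarith [mul_le_mul_of_nonneg_right hcK (h.nonneg k)]

/-- The exponent is chosen so that its `(p - 2)`-th power is exactly `1 / √r`. -/
theorem sqrt_mul_pow_le {r : ℕ} (hr : 0 < r) (hp : 3 ≤ p) {C₂ : ℝ} (hδ0 : 0 ≤ δ)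
    (hδ : δ ≤ C₂ * (r : ℝ) ^ (-(1 / (2 * ((p : ℝ) - 2))))) :
    √r * δ ^ (p - 2) ≤ C₂ ^ (p - 2) := by
  have hr' : (0 : ℝ) < r := by exact_mod_cast hr
  have hp' : ((p - 2 : ℕ) : ℝ) = (p : ℝ) - 2 := by
    rw [Nat.cast_sub (by omega)]; norm_num
  have hp2 : (p : ℝ) - 2 ≠ 0 := by
    have : (3 : ℝ) ≤ p := by exact_mod_cast hp
    linarith
  have h1 : ((r : ℝ) ^ (-(1 / (2 * ((p : ℝ) - 2))))) ^ (p - 2) = (√r)⁻¹ := by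
    rw [← Real.rpow_mul_natCast hr'.le, hp', Real.sqrt_eq_rpow, ← Real.rpow_neg hr'.le]
    congr 1
    field_simp
  calc √r * δ ^ (p - 2) ≤ √r * (C₂ * (r : ℝ) ^ (-(1 / (2 * ((p : ℝ) - 2))))) ^ (p - 2) := by
        gcongr
    _ = C₂ ^ (p - 2) := by
        rw [mul_pow, h1, mul_comm, mul_assoc, inv_mul_cancel₀ (Real.sqrt_pos.2 hr').ne', mul_one]

theorem activeSet_nonempty (v : Vecs d) (q : Fin p) (hv : ‖v q‖ = 1) (k : Fin (minDim d)) :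
    (activeSet u v).Nonempty := by
  by_cases hq : v q ∈ Submodule.span ℝ (Set.range (u q))
  · by_contra hcon
    have h0 : ∀ k, inner ℝ (v q) (u q k) = 0 := fun k => by
      by_contra hk
      exact hcon ⟨k, Or.inl ⟨q, hk⟩⟩
    obtain ⟨c, hc⟩ := (Submodule.mem_span_range_iff_exists_fun ℝ).1 hq
    have h1 : inner ℝ (v q) (v q) = 0 := by
      nth_rewrite 2 [← hc]
      rw [inner_sum]
      simp [inner_smul_right, h0]
    rw [inner_self_eq_zero] at h1
    rw [h1, norm_zero] at hv
    exact zero_ne_one hv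
  · exact ⟨k, Or.inr ⟨q, hq⟩⟩

theorem lamStar_le (v : Vecs d) {k : Fin (minDim d)} (hk : k ∈ activeSet u v) :
    lamStar lam u v ≤ lam k :=
  csInf_le (Set.toFinite _).bddBelow ⟨k, hk, rfl⟩

theorem exists_lamStar_eq (v : Vecs d) (hne : (activeSet u v).Nonempty) :
    ∃ k ∈ activeSet u v, lam k = lamStar lam u v :=
  (hne.image lam).csInf_mem (Set.toFinite _)

theorem sub_sum_eq_zero_or_forall_mem_activeSet (h : IsSVD T lam u) (v : Vecs d) :
    (∀ q, v q - ∑ k, (inner ℝ (u q k) (v q) : ℝ) • u q k = 0) ∨ ∀ k, k ∈ activeSet u v := by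
  by_cases hq : ∀ q, v q ∈ Submodule.span ℝ (Set.range (u q))
  · refine Or.inl fun q => ?_
    obtain ⟨c, hc⟩ := (Submodule.mem_span_range_iff_exists_fun ℝ).1 (hq q)
    rw [← hc]
    simp only [(h.orthonormal q).inner_right_fintype, sub_self]
  · push Not at hq
    exact Or.inr fun k => Or.inr hq

end Perturbation

end OdecoTensor

/-! ### The perturbation theorem -/

open OdecoTensor in
theorem mainTheorem3 (p : ℕ) (hp : 3 ≤ p) (C₁ C₂ : ℝ) (hC₁ : 0 < C₁) (hC₂ : 0 < C₂) :
    ∃ C : ℝ, 0 < C ∧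
      ∀ (d : Fin p → ℕ) (T T' : Tensor d)
        (lam : Fin (minDim d) → ℝ)
        (u : ∀ q, Fin (minDim d) → EuclideanSpace ℝ (Fin (d q)))
        (_ : IsSVD T lam u) (_ : IsOdeco T')
        (r : ℕ) (hr0 : 0 < r) (hr : r ≤ minDim d)
        (_ : ∀ k : Fin (minDim d), 0 < lam k ↔ (k : ℕ) < r)
        (_ : ∀ q, matNorm (contractMatrix (T' - T) hr u q) ≤ C₁ * tensorNorm (T' - T))
        (_ : tensorNorm (T' - T) ≤
          C₂ * lam ⟨r - 1, by omega⟩ * (r : ℝ) ^ (-(1 / (2 * ((p : ℝ) - 2)))))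
        (l : ℝ) (v : Vecs d) (_ : IsSingularTuple T l v),
        ∃ (l' : ℝ) (v' : Vecs d), IsSingularTuple T' l' v' ∧
          (∀ q, ENNReal.ofReal ‖v q - v' q‖ ≤
            ENNReal.ofReal (C * tensorNorm (T' - T)) / ENNReal.ofReal (lamStar lam u v)) ∧
          (0 < l → |l' - l| ≤ C * l * tensorNorm (T' - T) / lamStar lam u v) := by
  have hp' : (3 : ℝ) ≤ p := by exact_mod_cast hp
  set B : ℝ := C₂ ^ (p - 2) with hB
  have hB0 : 0 < B := pow_pos hC₂ _
  set K : ℝ := C₁ + 2 + 4 * 2 ^ (p - 2) * B with hK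
  have hK0 : 0 < K := by positivity
  -- The threshold between small and large `δ`: `δ ≤ c` yields both `4pδ ≤ 1` and `Kδ ≤ 1/2`.
  set c : ℝ := (4 * p + 2 * K)⁻¹ with hc
  have hc0 : 0 < c := by positivity
  -- Chosen to give `(K₀ - 1) * c ≥ 1` in `exists_lam_le`. Below, `D` bounds `√r ^ (p - 2)` once `δ
  -- > c`.
  set K₀ : ℝ := 4 + c⁻¹ with hK₀
  have hK₀0 : 0 < K₀ := by positivity
  set D : ℝ := (B / c ^ (p - 2)) ^ (p - 2) with hD
  have hD0 : 0 < D := by positivity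
  set C : ℝ := 3 * K + 16 + 2 * c⁻¹ + K₀ * D with hC
  have hC0 : 0 < C := by positivity
  refine ⟨C, hC0, ?_⟩
  intro d T T' lam u h hodeco r hr0 hr hlam hM hT l v hv
  obtain ⟨lam', u', h'⟩ := hodeco
  let q₀ : Fin p := ⟨0, by omega⟩
  let k₁ : Fin (minDim d) := ⟨r - 1, by omega⟩
  set ε := tensorNorm (T' - T) with hε
  have hclose : CloseBy ε T T' := closeBy_tensorNorm T T'
  have hε0 : 0 ≤ ε := (norm_nonneg _).trans (hclose q₀ v hv.1)
  obtain ⟨k₀, hk₀, hk₀L⟩ := exists_lamStar_eq (lam := lam) v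
    (activeSet_nonempty (u := u) v q₀ (hv.1 q₀) k₁)
  set L := lamStar lam u v with hL
  rcases hε0.eq_or_lt with hε1 | hε1
  · have hTT : T' = T := eq_of_tensorNorm_sub_eq_zero (by omega) hε1.symm
    exact ⟨l, v, hTT ▸ hv, fun q => by simp, fun _ => by simp [← hε1]⟩
  have hact : ∀ q k, inner ℝ (u q k) (v q) ≠ 0 → L ≤ lam k := fun q k hk =>
    lamStar_le v (Or.inl ⟨q, by rwa [real_inner_comm]⟩)
  rcases (show 0 ≤ L from hk₀L ▸ h.nonneg k₀).eq_or_lt with hL1 | hL0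
  -- When `L = 0` the vector bound is infinite, so any tuple of `T'` serves. A positive `l` is
  -- impossible, since an index with nonzero coefficient has `lam k > 0`.
  · refine ⟨lam' k₁, fun q => u' q k₁, isSingularTuple_self h' hp k₁, fun q => ?_, fun hl => ?_⟩
    · rw [← hL1, ENNReal.ofReal_zero, ENNReal.div_zero]
      · exact le_top
      · exact (ENNReal.ofReal_pos.2 (mul_pos hC0 hε1)).ne'
    · exfalso
      have hk := hk₀
      rw [activeSet_eq h hv hl.ne' q₀] at hk
      have h1 := hv.mul_inner h q₀ k₀
      rw [hk₀L, ← hL1, zero_mul, real_inner_comm] at h1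
      exact (mul_ne_zero hl.ne' hk) h1
  set δ := ε / L with hδ
  have hδ0 : 0 < δ := div_pos hε1 hL0
  have hδL : ε = δ * L := (div_mul_cancel₀ _ hL0.ne').symm
  have hlamr : lam k₁ ≤ L := by
    rw [← hk₀L]
    have h1 : (k₀ : ℕ) < r := (hlam k₀).1 (hk₀L ▸ hL0)
    exact h.antitone (Fin.le_def.2 (show (k₀ : ℕ) ≤ r - 1 by omega))
  have hrδ : √r * δ ^ (p - 2) ≤ B := by
    refine sqrt_mul_pow_le hr0 hp hδ0.le ((div_le_iff₀ hL0).2 (hT.trans ?_))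
    rw [mul_right_comm]
    gcongr
  suffices hmain : ∃ (l' : ℝ) (v' : Vecs d), IsSingularTuple T' l' v' ∧
      (∀ q, ‖v q - v' q‖ ≤ C * δ) ∧ (0 < l → |l' - l| ≤ C * l * δ) by
    obtain ⟨l', v', h1, h2, h3⟩ := hmain
    refine ⟨l', v', h1, fun q => ?_, fun hl => ?_⟩
    · rw [← ENNReal.ofReal_div_of_pos hL0, mul_div_assoc]
      exact ENNReal.ofReal_le_ofReal (h2 q)
    · rw [mul_div_assoc]
      exact h3 hl
  have hcinv : 0 < c⁻¹ := inv_pos.2 hc0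
  rcases le_or_gt δ c with hδc | hδc
  · have h1 : (4 * p + 2 * K) * δ ≤ 1 := by
      calc _ ≤ (4 * p + 2 * K) * c := by gcongr
        _ = 1 := mul_inv_cancel₀ (by positivity)
    have hKδ0 : 0 < K * δ := mul_pos hK0 hδ0
    have hpδ0 : 0 ≤ p * δ := by positivity
    obtain ⟨l', v', h2, h3, h4⟩ := exists_singularTuple_of_small h h' hp hε0 hclose hL0 hδ0.le
      hδL.le (by linarith) hr hlam hC₁.le hB0.le hM hrδ hK (by linarith) hv hact
      ((sub_sum_eq_zero_or_forall_mem_activeSet h v).imp_right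
        fun hall k => lamStar_le v (hall k))
    refine ⟨l', v', h2, fun q => (h3 q).trans ?_, fun hl => h4.trans ?_⟩
    · refine mul_le_mul_of_nonneg_right ?_ hδ0.le
      have : 0 < K₀ * D := by positivity
      linarith
    · rw [abs_of_pos hl]
      have : 4 ≤ C := by
        have : 0 < K₀ * D := by positivity
        linarith
      nlinarith [mul_le_mul_of_nonneg_right this (mul_pos hl hδ0).le]
  · have hδc1 : 1 ≤ c⁻¹ * δ := by
      rw [inv_mul_eq_div, one_le_div hc0]
      exact hδc.le
    obtain ⟨i, hi⟩ := exists_lam_le h h' hp hε1 hclose (c := c) (K := K₀)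
      (by linarith) (by rw [hK₀]; nlinarith [inv_mul_cancel₀ hc0.ne']) (k := k₀)
      (by rw [hk₀L, hδL]; exact mul_lt_mul_of_pos_right hδc hL0)
    refine ⟨lam' i, fun q => u' q i, isSingularTuple_self h' hp i, fun q => ?_, fun hl => ?_⟩
    · refine (norm_sub_le _ _).trans ?_
      rw [hv.1 q, (h'.orthonormal q).1 i]
      have : 0 < K₀ * D := by positivity
      nlinarith
    · have hrc : √r ≤ B / c ^ (p - 2) := by
        rw [le_div_iff₀ (by positivity)]
        refine le_trans ?_ hrδ
        gcongr
      -- Since `δ > c`, the bound on `√r δ^(p-2)` bounds `r` itself, so `L` is at most a constant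
      -- times `l`.
      have h1 : ε ≤ l * D * δ := by
        rw [hδL, mul_comm]
        refine mul_le_mul_of_nonneg_right ?_ hδ0.le
        refine (hv.le_mul_sqrt_pow h hp hl hL0 hlam hact).trans ?_
        rw [hD]
        gcongr
      have h2 : |lam' i - l| ≤ lam' i + l := by
        rw [abs_le]
        constructor <;> linarith [h'.nonneg i]
      have h3 : l ≤ c⁻¹ * (l * δ) := by nlinarith
      have h4 : K₀ * ε ≤ K₀ * (l * D * δ) := mul_le_mul_of_nonneg_left h1 hK₀0.le
      have h5 : 0 ≤ (3 * K + 16 + c⁻¹) * (l * δ) := by positivity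
      rw [hC]
      linarith
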